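/- Let $I=[0,1]$ or $I=[0,\infty)$ with Lebesgue measure $m$, and let $L^0(I)$ be the space of a.e.-equivalence classes of real measurable functions on $I$. A Banach ideal space on $I$ is a Banach space $X\subset L^0(I)$ such that $f\in L^0(I)$, $g\in X$, $|f|\le|g|$ a.e. imply $f\in X$ and $\|f\|_X\le\|g\|_X$, and which contains some $f$ with $f>0$ a.e. on $I$. It is symmetric if $f\in X$, $g\in L^0(I)$ and $m\{|f|>\lambda\}=m\{|g|>\lambda\}$ for all $\lambda>0$ imply $g\in X$ and $\|g\|_X=\|f\|_X$. It has the Fatou property if $0\le f_n\nearrow f$ a.e. with $f_n\in X$, $f\in L^0(I)$ and $\sup_n\|f_n\|_X<\infty$ imply $f\in X$ and $\|f_n\|_X\nearrow\|f\|_X$. The Köthe dual $X'$ is the space of all $f\in L^0(I)$ with $\|f\|_{X'}=\sup\{\int_I|fg|\,dm: g\in X,\ \|g\|_X\le1\}<\infty$. Put $$Cf(x)=\frac1x\int_0^x f(t)\,dt,\qquad C^*f(x)=\int_{I\cap[x,\infty)}\frac{f(t)}{t}\,dt,\qquad \widetilde f(x)=\operatorname*{ess\,sup}_{t\in I,\ t\ge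 x}|f(t)|,$$ $CX=\{f\in L^0(I): C|f|\in X\}$ with $\|f\|_{CX}=\|C|f|\|_X$, and $\widetilde X=\{f\in L^0(I):\widetilde f\in X\}$ with $\|f\|_{\widetilde X}=\|\widetilde f\|_X$ (the latter definition is applied to $X'$ as well). A Banach space $E$ has the Dunford–Pettis property if $x_n^*(x_n)\to0$ whenever $x_n\to0$ weakly in $E$ and $x_n^*\to0$ weakly in $E^*$. **Theorem.** Let $X$ be a reflexive symmetric Banach ideal space on $I$ such that the operator $C$ is bounded on $X$. (i) If $I=[0,\infty)$, then neither $CX$ nor $\widetilde{X'}$ has the Dunford–Pettis property. (ii) If $I=[0,1]$, $X$ has the Fatou property and $C^*$ is bounded on $X$, then neither $CX$ nor $\widetilde{X'}$ has the Dunford–Pettis property. -/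

import Mathlib

open MeasureTheory Set Filter Topology
open scoped ENNReal

noncomputable section

/-! ### Weak sequential notions in a real normed space -/

/-- The Dunford-Pettis property: `φ n (x n) → 0` whenever `x n → 0` weakly in `E` and `φ n → 0`
weakly in the dual `E*` (that is, against every element of the bidual). -/
def HasDunfordPettis (E : Type*) [NormedAddCommGroup E] [NormedSpace ℝ E] : Prop :=
  ∀ (x : ℕ → E) (φ : ℕ → StrongDual ℝ E),
    (∀ ψ : StrongDual ℝ E, Tendsto (fun n => ψ (x n)) atTop (𝓝 0)) →
    (∀ Ψ : StrongDual ℝ (StrongDual ℝ E), Tendsto (fun n => Ψ (φ n)) atTop (𝓝 0)) →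
    Tendsto (fun n => φ n (x n)) atTop (𝓝 0)

/-- Reflexivity: the canonical embedding into the bidual is onto. -/
def IsReflexiveSpace (E : Type*) [NormedAddCommGroup E] [NormedSpace ℝ E] : Prop :=
  Function.Surjective (NormedSpace.inclusionInDoubleDual ℝ E)

/-! ### Function spaces on `I` -/

/-- The interval `I` is `[0, 1]` or `[0, ∞)`. -/
class IsBaseInterval (I : Set ℝ) : Prop where
  eq_or_eq : I = Icc 0 1 ∨ I = Ici 0

instance isBaseInterval_unit : IsBaseInterval (Icc (0 : ℝ) 1) := ⟨Or.inl rfl⟩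

instance isBaseInterval_halfLine : IsBaseInterval (Ici (0 : ℝ)) := ⟨Or.inr rfl⟩

/-- Lebesgue measure on `I`. -/
abbrev leb (I : Set ℝ) : Measure ℝ := volume.restrict I

/-- `L⁰(I)`: classes of measurable real functions on `I` modulo equality almost everywhere. -/
abbrev LZero (I : Set ℝ) : Type := ℝ →ₘ[leb I] ℝ

/-- A normed ideal space on `I`: a linear subspace of `L⁰(I)` with a norm that has the ideal
property. Neither completeness nor full support is part of this notion. -/
structure NormedIdealSpace (I : Set ℝ) where
  toSubmodule : Submodule ℝ (LZero I)
  normFun : toSubmodule → ℝ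
  normFun_nonneg : ∀ f, 0 ≤ normFun f
  normFun_smul : ∀ (c : ℝ) (f), normFun (c • f) = ‖c‖ * normFun f
  normFun_triangle : ∀ f g, normFun (f + g) ≤ normFun f + normFun g
  normFun_eq_zero : ∀ f, normFun f = 0 ↔ f = 0
  ideal : ∀ (f : LZero I) (g : toSubmodule), (∀ᵐ x ∂leb I, |f x| ≤ |(g : LZero I) x|) →
    ∃ hf : f ∈ toSubmodule, normFun ⟨f, hf⟩ ≤ normFun g

namespace NormedIdealSpace

variable {I : Set ℝ}

instance instCoeSort : CoeSort (NormedIdealSpace I) Type := ⟨fun X => X.toSubmodule⟩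

instance instNorm (X : NormedIdealSpace I) : Norm X := ⟨X.normFun⟩

theorem core (X : NormedIdealSpace I) : NormedSpace.Core ℝ X where
  norm_nonneg := X.normFun_nonneg
  norm_smul := X.normFun_smul
  norm_triangle := X.normFun_triangle
  norm_eq_zero_iff := X.normFun_eq_zero

instance instNormedAddCommGroup (X : NormedIdealSpace I) : NormedAddCommGroup X :=
  NormedAddCommGroup.ofCore X.core

instance instNormedSpace (X : NormedIdealSpace I) : NormedSpace ℝ X :=
  NormedSpace.ofCore X.core

/-- The norm has the Fatou property: if `0 ≤ f n ↗ g` a.e. with `f n ∈ X` and bounded norms,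
then `g ∈ X` and `‖f n‖ → ‖g‖` (the norms increase by the ideal property). -/
def HasFatou (X : NormedIdealSpace I) : Prop :=
  ∀ (f : ℕ → X) (g : LZero I),
    (∀ᵐ x ∂leb I, (∀ n, 0 ≤ (f n : LZero I) x) ∧ Monotone (fun n => (f n : LZero I) x) ∧
      Tendsto (fun n => (f n : LZero I) x) atTop (𝓝 (g x))) →
    BddAbove (range fun n => ‖f n‖) →
    ∃ hg : g ∈ X.toSubmodule, Tendsto (fun n => ‖f n‖) atTop (𝓝 ‖(⟨g, hg⟩ : X)‖)

/-- The distribution function `d_f(s) = m {x ∈ I : |f x| > s}`. -/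
def distrib (f : LZero I) (s : ℝ) : ℝ≥0∞ := leb I {x | s < |f x|}

/-- Symmetric (rearrangement invariant) spaces. -/
def IsSymmetric (X : NormedIdealSpace I) : Prop :=
  ∀ (f : X) (g : LZero I), (∀ s : ℝ, 0 < s → distrib (f : LZero I) s = distrib g s) →
    ∃ hg : g ∈ X.toSubmodule, ‖(⟨g, hg⟩ : X)‖ = ‖f‖

/-- The Cesàro operator `C f (x) = (1 / x) ∫₀ˣ f` is (everywhere defined and) bounded on `X`. -/
def CesaroBounded (X : NormedIdealSpace I) : Prop :=
  ∃ A : ℝ, ∀ f : X, ∃ g : X, ‖g‖ ≤ A * ‖f‖ ∧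
    ∀ᵐ x ∂leb I, IntegrableOn (f : LZero I) (Ioc 0 x) (leb I) ∧
      (g : LZero I) x = x⁻¹ * ∫ t in Ioc 0 x, (f : LZero I) t ∂leb I

/-- The Copson operator `C* f (x) = ∫_{I ∩ [x, ∞)} f(t) / t dt` is (everywhere defined and)
bounded on `X`. -/
def CopsonBounded (X : NormedIdealSpace I) : Prop :=
  ∃ A : ℝ, ∀ f : X, ∃ g : X, ‖g‖ ≤ A * ‖f‖ ∧
    ∀ᵐ x ∂leb I, IntegrableOn (fun t => (f : LZero I) t / t) (Ici x) (leb I) ∧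
      (g : LZero I) x = ∫ t in Ici x, (f : LZero I) t / t ∂leb I

/-- `X` is complete, i.e. a Banach space. -/
def IsBanach (X : NormedIdealSpace I) : Prop := CompleteSpace X

/-- `X` contains a weak unit, i.e. a function which is positive almost everywhere on `I`. -/
def HasWeakUnit (X : NormedIdealSpace I) : Prop :=
  ∃ f : X, ∀ᵐ x ∂leb I, 0 < (f : LZero I) x

end NormedIdealSpace

/-- A Banach ideal space on `I`: a complete normed ideal space that contains a weak unit. -/
structure BanachIdealSpace (I : Set ℝ) extends NormedIdealSpace I where
  isBanach : toNormedIdealSpace.IsBanach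
  weakUnit : toNormedIdealSpace.HasWeakUnit

/-! ### The Köthe dual -/

namespace BanachIdealSpace

variable {I : Set ℝ}

/-- The associated norm `sup { ∫_I |f g| : g ∈ X, ‖g‖ ≤ 1 }`, with values in `[0, ∞]`. -/
def assocNorm (X : BanachIdealSpace I) (f : LZero I) : ℝ≥0∞ :=
  ⨆ (g : X.toNormedIdealSpace) (_ : ‖g‖ ≤ 1), ∫⁻ x, ‖f x * (g : LZero I) x‖ₑ ∂leb I

theorem assocNorm_mono (X : BanachIdealSpace I) {f g : LZero I}
    (h : ∀ᵐ x ∂leb I, |f x| ≤ |g x|) : X.assocNorm f ≤ X.assocNorm g := by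
  refine iSup₂_mono fun k _ => lintegral_mono_ae ?_
  filter_upwards [h] with x hx
  rw [enorm_mul, enorm_mul]
  gcongr
  exact enorm_le_iff_norm_le.2 hx

theorem assocNorm_smul (X : BanachIdealSpace I) (c : ℝ) (f : LZero I) :
    X.assocNorm (c • f) = ‖c‖ₑ * X.assocNorm f := by
  unfold assocNorm
  simp only [ENNReal.mul_iSup]
  refine iSup_congr fun k => iSup_congr fun _ => ?_
  rw [← lintegral_const_mul' _ _ enorm_ne_top]
  refine lintegral_congr_ae ?_
  filter_upwards [AEEqFun.coeFn_smul c f] with x hx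
  rw [hx, Pi.smul_apply, smul_eq_mul, mul_assoc, enorm_mul]

theorem assocNorm_add (X : BanachIdealSpace I) (f g : LZero I) :
    X.assocNorm (f + g) ≤ X.assocNorm f + X.assocNorm g := by
  refine iSup₂_le fun k hk => ?_
  have h1 : ∫⁻ x, ‖(f + g) x * (k : LZero I) x‖ₑ ∂leb I ≤
      ∫⁻ x, (‖f x * (k : LZero I) x‖ₑ + ‖g x * (k : LZero I) x‖ₑ) ∂leb I := by
    refine lintegral_mono_ae ?_
    filter_upwards [AEEqFun.coeFn_add f g] with x hx
    rw [hx, Pi.add_apply, add_mul]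
    exact enorm_add_le _ _
  refine h1.trans ?_
  have hm : AEMeasurable (fun x => ‖f x * (k : LZero I) x‖ₑ) (leb I) :=
    (f.aestronglyMeasurable.mul (k : LZero I).aestronglyMeasurable).enorm
  rw [lintegral_add_left' hm]
  exact add_le_add (le_iSup₂_of_le k hk le_rfl) (le_iSup₂_of_le k hk le_rfl)

theorem assocNorm_eq_zero (X : BanachIdealSpace I) {f : LZero I} (h : X.assocNorm f = 0) :
    f = 0 := by
  obtain ⟨w, hw⟩ := X.weakUnit
  have hc : 0 < (‖w‖ + 1)⁻¹ := by positivity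
  have hle : ‖(‖w‖ + 1)⁻¹ • w‖ ≤ 1 := by
    rw [norm_smul, Real.norm_of_nonneg hc.le, inv_mul_le_one₀ (by positivity)]
    linarith
  have h0 : ∫⁻ x, ‖f x * (((‖w‖ + 1)⁻¹ • w : X.toNormedIdealSpace) : LZero I) x‖ₑ ∂leb I = 0 :=
    le_antisymm (h ▸ le_iSup₂_of_le
      (f := fun (g : X.toNormedIdealSpace) (_ : ‖g‖ ≤ 1) =>
        ∫⁻ x, ‖f x * (g : LZero I) x‖ₑ ∂leb I) _ hle le_rfl) bot_le
  have hm : AEMeasurable (fun x =>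
      ‖f x * (((‖w‖ + 1)⁻¹ • w : X.toNormedIdealSpace) : LZero I) x‖ₑ) (leb I) :=
    (f.aestronglyMeasurable.mul
      (((‖w‖ + 1)⁻¹ • w : X.toNormedIdealSpace) : LZero I).aestronglyMeasurable).enorm
  rw [lintegral_eq_zero_iff' hm] at h0
  refine AEEqFun.ext ?_
  filter_upwards [h0, hw, AEEqFun.coeFn_smul (‖w‖ + 1)⁻¹ (w : LZero I),
    AEEqFun.coeFn_zero (α := ℝ) (μ := leb I) (β := ℝ)] with x h1 h2 h3 h4
  rw [h4]
  have h5 : f x * ((‖w‖ + 1)⁻¹ • (w : LZero I) x) = 0 := by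
    have := h1
    simp only [Submodule.coe_smul, Pi.zero_apply, enorm_eq_zero] at this
    rwa [h3] at this
  rcases mul_eq_zero.1 h5 with h6 | h6
  · simpa using h6
  · exact absurd h6 (by simp only [smul_eq_mul]; positivity)

/-- The Köthe dual `X'`: all `f ∈ L⁰(I)` with finite associated norm. -/
def kotheDual (X : BanachIdealSpace I) : NormedIdealSpace I where
  toSubmodule :=
    { carrier := {f | X.assocNorm f ≠ ∞}
      zero_mem' := by
        have := X.assocNorm_smul 0 0
        simp only [zero_smul, enorm_zero, zero_mul] at this
        simp [this]
      add_mem' := fun {f g} hf hg =>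
        ne_top_of_le_ne_top (ENNReal.add_ne_top.2 ⟨hf, hg⟩) (X.assocNorm_add f g)
      smul_mem' := fun c f hf => by
        change X.assocNorm (c • f) ≠ ∞
        rw [assocNorm_smul]
        exact ENNReal.mul_ne_top enorm_ne_top hf }
  normFun f := (X.assocNorm (f : LZero I)).toReal
  normFun_nonneg _ := ENNReal.toReal_nonneg
  normFun_smul c f := by
    rw [Submodule.coe_smul, assocNorm_smul, ENNReal.toReal_mul, toReal_enorm]
  normFun_triangle f g := by
    rw [← ENNReal.toReal_add f.2 g.2]
    exact ENNReal.toReal_mono (ENNReal.add_ne_top.2 ⟨f.2, g.2⟩) (X.assocNorm_add _ _)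
  normFun_eq_zero f := by
    constructor
    · intro h
      refine Subtype.ext (X.assocNorm_eq_zero ?_)
      exact (ENNReal.toReal_eq_zero_iff _).1 h |>.resolve_right f.2
    · rintro rfl
      have := X.assocNorm_smul 0 0
      simp only [zero_smul, enorm_zero, zero_mul] at this
      simp [this]
  ideal f g h := by
    have hle := X.assocNorm_mono h
    exact ⟨ne_top_of_le_ne_top g.2 hle, ENNReal.toReal_mono g.2 hle⟩

end BanachIdealSpace

/-! ### Cesàro and Tandori spaces -/

/-- A positive sublinear operator on `L⁰(I)` with values in `[0, ∞]`-valued functions. -/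
structure SublinearOp (I : Set ℝ) where
  toFun : LZero I → ℝ → ℝ≥0∞
  meas : ∀ f, Measurable (toFun f)
  mono : ∀ f g : LZero I, (∀ᵐ x ∂leb I, |f x| ≤ |g x|) → ∀ x, toFun f x ≤ toFun g x
  map_add_le : ∀ f g x, toFun (f + g) x ≤ toFun f x + toFun g x
  map_smul : ∀ (c : ℝ) f x, toFun (c • f) x = ‖c‖ₑ * toFun f x
  eq_zero : ∀ f, (∀ᵐ x ∂leb I, toFun f x = 0) → f = 0

namespace SublinearOp

variable {I : Set ℝ}

/-- `T f` as an element of `L⁰(I)`; meaningful when `T f` is finite almost everywhere. -/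
def toLZero (T : SublinearOp I) (f : LZero I) : LZero I :=
  AEEqFun.mk (fun x => (T.toFun f x).toReal)
    (T.meas f).ennreal_toReal.aestronglyMeasurable

theorem coeFn_toLZero (T : SublinearOp I) (f : LZero I) :
    ∀ᵐ x ∂leb I, T.toLZero f x = (T.toFun f x).toReal :=
  AEEqFun.coeFn_mk _ _

/-- `f` belongs to the domain: `T f` is finite a.e. and is an element of `X`. -/
def Dom (T : SublinearOp I) (X : NormedIdealSpace I) (f : LZero I) : Prop :=
  (∀ᵐ x ∂leb I, T.toFun f x ≠ ∞) ∧ T.toLZero f ∈ X.toSubmodule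

theorem dom_mono (T : SublinearOp I) (X : NormedIdealSpace I) {f g : LZero I}
    (h : ∀ᵐ x ∂leb I, |f x| ≤ |g x|) (hg : T.Dom X g) :
    ∃ hf : T.Dom X f, ‖(⟨_, hf.2⟩ : X)‖ ≤ ‖(⟨_, hg.2⟩ : X)‖ := by
  have hm := T.mono f g h
  obtain ⟨h1, h2⟩ := X.ideal (T.toLZero f) ⟨_, hg.2⟩ (by
    filter_upwards [T.coeFn_toLZero f, T.coeFn_toLZero g, hg.1] with x h1 h2 h3
    rw [h1, h2, abs_of_nonneg ENNReal.toReal_nonneg, abs_of_nonneg ENNReal.toReal_nonneg]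
    exact ENNReal.toReal_mono h3 (hm x))
  exact ⟨⟨hg.1.mono fun x hx => ne_top_of_le_ne_top hx (hm x), h1⟩, h2⟩

theorem dom_add (T : SublinearOp I) (X : NormedIdealSpace I) {f g : LZero I}
    (hf : T.Dom X f) (hg : T.Dom X g) :
    ∃ h : T.Dom X (f + g),
      ‖(⟨_, h.2⟩ : X)‖ ≤ ‖(⟨_, hf.2⟩ : X)‖ + ‖(⟨_, hg.2⟩ : X)‖ := by
  obtain ⟨h1, h2⟩ := X.ideal (T.toLZero (f + g)) (⟨_, hf.2⟩ + ⟨_, hg.2⟩) (by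
    filter_upwards [T.coeFn_toLZero f, T.coeFn_toLZero g, T.coeFn_toLZero (f + g), hf.1, hg.1,
      AEEqFun.coeFn_add (T.toLZero f) (T.toLZero g)] with x h1 h2 h3 h4 h5 h6
    simp only [Submodule.coe_add]
    rw [h6, h3, Pi.add_apply, h1, h2, abs_of_nonneg ENNReal.toReal_nonneg,
      ← ENNReal.toReal_add h4 h5, abs_of_nonneg ENNReal.toReal_nonneg]
    exact ENNReal.toReal_mono (ENNReal.add_ne_top.2 ⟨h4, h5⟩) (T.map_add_le f g x))
  refine ⟨⟨?_, h1⟩, h2.trans (X.normFun_triangle _ _)⟩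
  filter_upwards [hf.1, hg.1] with x h4 h5
  exact ne_top_of_le_ne_top (ENNReal.add_ne_top.2 ⟨h4, h5⟩) (T.map_add_le f g x)

theorem toLZero_smul (T : SublinearOp I) (c : ℝ) (f : LZero I) :
    T.toLZero (c • f) = ‖c‖ • T.toLZero f := by
  refine AEEqFun.ext ?_
  filter_upwards [T.coeFn_toLZero f, T.coeFn_toLZero (c • f),
    AEEqFun.coeFn_smul ‖c‖ (T.toLZero f)] with x h1 h2 h3
  rw [h2, h3, Pi.smul_apply, h1, T.map_smul, ENNReal.toReal_mul, toReal_enorm, smul_eq_mul]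

theorem dom_smul (T : SublinearOp I) (X : NormedIdealSpace I) (c : ℝ) {f : LZero I}
    (hf : T.Dom X f) : T.Dom X (c • f) := by
  refine ⟨hf.1.mono fun x hx => ?_, ?_⟩
  · rw [T.map_smul]
    exact ENNReal.mul_ne_top enorm_ne_top hx
  · rw [T.toLZero_smul]
    exact X.toSubmodule.smul_mem _ hf.2

theorem toLZero_eq_zero (T : SublinearOp I) {f : LZero I} (h1 : ∀ᵐ x ∂leb I, T.toFun f x ≠ ∞)
    (h2 : T.toLZero f = 0) : f = 0 := by
  refine T.eq_zero f ?_
  filter_upwards [h1, T.coeFn_toLZero f, AEEqFun.coeFn_zero (α := ℝ) (μ := leb I) (β := ℝ)]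
    with x h3 h4 h5
  rw [h2, h5] at h4
  exact ((ENNReal.toReal_eq_zero_iff _).1 h4.symm).resolve_right h3

theorem dom_zero (T : SublinearOp I) (X : NormedIdealSpace I) : T.Dom X 0 := by
  have h : ∀ x, T.toFun 0 x = 0 := fun x => by simpa using T.map_smul 0 0 x
  have h' : T.toLZero 0 = 0 := by simpa using T.toLZero_smul 0 0
  refine ⟨by simp [h], ?_⟩
  rw [h']
  exact X.toSubmodule.zero_mem

/-- The space of all `f ∈ L⁰(I)` with `T f ∈ X`, with the norm `‖T f‖_X`. -/
def pullback (T : SublinearOp I) (X : NormedIdealSpace I) : NormedIdealSpace I where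
  toSubmodule :=
    { carrier := {f | T.Dom X f}
      zero_mem' := T.dom_zero X
      add_mem' := fun hf hg => (T.dom_add X hf hg).1
      smul_mem' := fun c _ hf => T.dom_smul X c hf }
  normFun f := ‖(⟨T.toLZero f, f.2.2⟩ : X)‖
  normFun_nonneg _ := norm_nonneg _
  normFun_smul c f := by
    have : (⟨T.toLZero (c • (f : LZero I)), (T.dom_smul X c f.2).2⟩ : X) =
        ‖c‖ • ⟨T.toLZero f, f.2.2⟩ := Subtype.ext (T.toLZero_smul c f)
    refine (congrArg norm this).trans ?_
    rw [norm_smul, norm_norm]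
  normFun_triangle f g := (T.dom_add X f.2 g.2).2
  normFun_eq_zero f := by
    rw [norm_eq_zero]
    constructor
    · intro h
      exact Subtype.ext (T.toLZero_eq_zero f.2.1 (congrArg Subtype.val h))
    · rintro rfl
      exact Subtype.ext (by simpa using T.toLZero_smul 0 0)
  ideal f g h := T.dom_mono X h g.2

end SublinearOp

section Operators

variable {I : Set ℝ}

theorem ae_leb_pos [hI : IsBaseInterval I] : ∀ᵐ x ∂leb I, 0 < x := by
  have h : MeasurableSet I := by
    rcases hI.eq_or_eq with rfl | rfl
    · exact measurableSet_Icc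
    · exact measurableSet_Ici
  rw [leb, ae_restrict_iff' h]
  filter_upwards [Measure.ae_ne volume (0 : ℝ)] with x hx hxI
  rcases hI.eq_or_eq with rfl | rfl
  · exact lt_of_le_of_ne hxI.1 hx.symm
  · exact lt_of_le_of_ne hxI hx.symm

theorem exists_small [hI : IsBaseInterval I] {p : ℝ → Prop} (hp : ∀ᵐ x ∂leb I, p x) {q : ℝ}
    (hq : 0 < q) : ∃ x, p x ∧ x < q := by
  have hsub : Ioo 0 (min q 1) ⊆ I := by
    rcases hI.eq_or_eq with rfl | rfl
    · exact fun x hx => ⟨hx.1.le, (hx.2.trans_le (min_le_right _ _)).le⟩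
    · exact fun x hx => hx.1.le
  have h1 : ∀ᵐ x ∂volume.restrict (Ioo 0 (min q 1)), p x ∧ x < q :=
    (ae_restrict_of_ae_restrict_of_subset hsub hp).and
      ((ae_restrict_mem measurableSet_Ioo).mono fun x hx => hx.2.trans_le (min_le_left _ _))
  have : (ae (volume.restrict (Ioo 0 (min q 1)))).NeBot := by
    rw [ae_neBot, Ne, Measure.restrict_eq_zero, Real.volume_Ioo]
    simp [hq]
  exact h1.exists

theorem exists_large [hI : IsBaseInterval I] {p : ℝ → Prop} (hp : ∀ᵐ x ∂leb I, p x) {q : ℝ}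
    (hq : 0 < q) (hqI : ∃ r ∈ I, q < r) : ∃ x, p x ∧ q < x := by
  obtain ⟨r, hr, hqr⟩ := hqI
  have hsub : Ioo q r ⊆ I := by
    rcases hI.eq_or_eq with rfl | rfl
    · exact fun x hx => ⟨(hq.trans hx.1).le, hx.2.le.trans hr.2⟩
    · exact fun x hx => (hq.trans hx.1).le
  have h1 : ∀ᵐ x ∂volume.restrict (Ioo q r), p x ∧ q < x :=
    (ae_restrict_of_ae_restrict_of_subset hsub hp).and
      ((ae_restrict_mem measurableSet_Ioo).mono fun x hx => hx.1)
  have : (ae (volume.restrict (Ioo q r))).NeBot := by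
    rw [ae_neBot, Ne, Measure.restrict_eq_zero, Real.volume_Ioo]
    simp [hqr]
  exact h1.exists

theorem enorm_le_of_abs_le {f g : LZero I} (h : ∀ᵐ x ∂leb I, |f x| ≤ |g x|) :
    ∀ᵐ x ∂leb I, ‖f x‖ₑ ≤ ‖g x‖ₑ :=
  h.mono fun _ hx => enorm_le_iff_norm_le.2 hx

theorem enorm_add_le_ae (f g : LZero I) :
    ∀ᵐ x ∂leb I, ‖(f + g) x‖ₑ ≤ ‖f x‖ₑ + ‖g x‖ₑ := by
  filter_upwards [AEEqFun.coeFn_add f g] with x hx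
  rw [hx]
  exact enorm_add_le _ _

theorem enorm_smul_ae (c : ℝ) (f : LZero I) :
    ∀ᵐ x ∂leb I, ‖(c • f) x‖ₑ = ‖c‖ₑ * ‖f x‖ₑ := by
  filter_upwards [AEEqFun.coeFn_smul c f] with x hx
  rw [hx, Pi.smul_apply, smul_eq_mul, enorm_mul]

/-- `f ↦ C|f|`, where `C|f|(x) = (1 / x) ∫₀ˣ |f(t)| dt ∈ [0, ∞]` for `0 < x ∈ I`. -/
def cesaroOp (I : Set ℝ) [IsBaseInterval I] : SublinearOp I where
  toFun f x := (∫⁻ t in Ioc 0 x, ‖f t‖ₑ ∂leb I) / ENNReal.ofReal x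
  meas f := by
    refine Measurable.div (Monotone.measurable fun x y hxy => ?_) ENNReal.measurable_ofReal
    exact lintegral_mono_set (Ioc_subset_Ioc_right hxy)
  mono f g h x := ENNReal.div_le_div_right
    (lintegral_mono_ae (ae_restrict_of_ae (enorm_le_of_abs_le h))) _
  map_add_le f g x := by
    rw [← ENNReal.add_div]
    refine ENNReal.div_le_div_right ?_ _
    rw [← lintegral_add_left' f.aestronglyMeasurable.enorm.restrict]
    exact lintegral_mono_ae (ae_restrict_of_ae (enorm_add_le_ae f g))
  map_smul c f x := by
    rw [← mul_div_assoc, ← lintegral_const_mul' _ _ enorm_ne_top]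
    congr 1
    exact lintegral_congr_ae (ae_restrict_of_ae (enorm_smul_ae c f))
  eq_zero f h := by
    have key : ∀ q : ℚ, 0 < (q : ℝ) → (∃ r ∈ I, (q : ℝ) < r) →
        ∀ᵐ t ∂leb I, t ∈ Ioc 0 (q : ℝ) → f t = 0 := by
      intro q hq hqI
      obtain ⟨x, hx, hqx⟩ := exists_large h hq hqI
      rw [ENNReal.div_eq_zero_iff] at hx
      have hx' := hx.resolve_right ENNReal.ofReal_ne_top
      rw [lintegral_eq_zero_iff' f.aestronglyMeasurable.enorm.restrict] at hx'
      have hx2 := (ae_restrict_iff' measurableSet_Ioc).1 hx'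
      filter_upwards [hx2] with t ht htq
      simpa using ht ⟨htq.1, htq.2.trans hqx.le⟩
    have hall : ∀ᵐ t ∂leb I, ∀ q : ℚ, 0 < (q : ℝ) → (∃ r ∈ I, (q : ℝ) < r) →
        t ∈ Ioc 0 (q : ℝ) → f t = 0 := by
      rw [ae_all_iff]
      intro q
      by_cases hq : 0 < (q : ℝ) ∧ ∃ r ∈ I, (q : ℝ) < r
      · filter_upwards [key q hq.1 hq.2] with t ht _ _ using ht
      · exact Eventually.of_forall fun t h1 h2 => absurd ⟨h1, h2⟩ hq
    have hlt : ∀ᵐ t ∂leb I, ∃ r ∈ I, t < r := by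
      rcases (inferInstance : IsBaseInterval I).eq_or_eq with rfl | rfl
      · rw [leb, ae_restrict_iff' measurableSet_Icc]
        filter_upwards [Measure.ae_ne volume (1 : ℝ)] with t ht htI
        exact ⟨1, by simp, lt_of_le_of_ne htI.2 ht⟩
      · rw [leb, ae_restrict_iff' measurableSet_Ici]
        exact Eventually.of_forall fun t ht => ⟨t + 1, by simp only [mem_Ici] at *; linarith,
          by linarith⟩
    refine AEEqFun.ext ?_
    filter_upwards [hall, hlt, ae_leb_pos (I := I),
      AEEqFun.coeFn_zero (α := ℝ) (μ := leb I) (β := ℝ)] with t h1 h2 h3 h4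
    obtain ⟨r, hr, htr⟩ := h2
    obtain ⟨q, hq1, hq2⟩ := exists_rat_btwn htr
    rw [h1 q (h3.trans hq1) ⟨r, hr, hq2⟩ ⟨h3, hq1.le⟩, h4, Pi.zero_apply]

/-- The decreasing majorant `f ↦ f~`, `f~(x) = ess sup_{t ∈ I, t ≥ x} |f(t)| ∈ [0, ∞]`. -/
def majorantOp (I : Set ℝ) [IsBaseInterval I] : SublinearOp I where
  toFun f x := essSup (fun t => ‖f t‖ₑ) ((leb I).restrict (Ici x))
  meas f := by
    refine Antitone.measurable fun x y hxy => ?_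
    exact essSup_mono_measure' (Measure.restrict_mono (Ici_subset_Ici.2 hxy) le_rfl)
  mono f g h x := essSup_mono_ae (ae_restrict_of_ae (enorm_le_of_abs_le h))
  map_add_le f g x := by
    refine (essSup_mono_ae (ae_restrict_of_ae (enorm_add_le_ae f g))).trans ?_
    exact ENNReal.essSup_add_le _ _
  map_smul c f x := by
    rw [← ENNReal.essSup_const_mul]
    exact essSup_congr_ae (ae_restrict_of_ae (enorm_smul_ae c f))
  eq_zero f h := by
    have key : ∀ q : ℚ, 0 < (q : ℝ) → ∀ᵐ t ∂leb I, t ∈ Ici (q : ℝ) → f t = 0 := by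
      intro q hq
      obtain ⟨x, hx, hxq⟩ := exists_small h hq
      rw [ENNReal.essSup_eq_zero_iff] at hx
      have hx2 := (ae_restrict_iff' measurableSet_Ici).1 hx
      filter_upwards [hx2] with t ht htq
      simpa using ht (hxq.le.trans htq)
    have hall : ∀ᵐ t ∂leb I, ∀ q : ℚ, 0 < (q : ℝ) → t ∈ Ici (q : ℝ) → f t = 0 := by
      rw [ae_all_iff]
      intro q
      by_cases hq : 0 < (q : ℝ)
      · filter_upwards [key q hq] with t ht _ using ht
      · exact Eventually.of_forall fun t h1 => absurd h1 hq
    refine AEEqFun.ext ?_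
    filter_upwards [hall, ae_leb_pos (I := I),
      AEEqFun.coeFn_zero (α := ℝ) (μ := leb I) (β := ℝ)] with t h1 h3 h4
    obtain ⟨q, hq1, hq2⟩ := exists_rat_btwn h3
    rw [h1 q hq1 hq2.le, h4, Pi.zero_apply]

variable [IsBaseInterval I]

/-- The Cesàro space `CX = {f : C|f| ∈ X}` with `‖f‖ = ‖C|f|‖_X`. -/
def cesaroSpace (X : NormedIdealSpace I) : NormedIdealSpace I := (cesaroOp I).pullback X

/-- The Tandori space `X~ = {f : f~ ∈ X}` with `‖f‖ = ‖f~‖_X`. -/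
def tandoriSpace (X : NormedIdealSpace I) : NormedIdealSpace I := (majorantOp I).pullback X

end Operators

end

noncomputable section

/-! ### Weak convergence in reflexive spaces -/

/-! The Dunford–Pettis property fails for a space `E` when there are bounded maps from one
reflexive-type space into `E` and from `E` onward whose composite keeps some weakly null sequence
visible to a weakly null sequence of functionals. Here the composites are Hardy operators.
Boundedness of `C` on `X` gives `X → CX → X`, an inclusion followed by `C`; by duality `C*` is
bounded on `X'`, and since `C*|f|` is decreasing it gives `X' → X'~ → X'`, that is, `C*` followed by
an inclusion.

The test sequences live on dyadic intervals shrinking to `0`, so one argument serves both choices of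
`I`. Let `e n` and `d n` be the indicators of `(2^(-n-1), 2^(-n)]` and `(2^(-n-2), 2^(-n-1)]`, and
put `u n = e (n+2) / ‖e (n+2)‖` in `X` and `v n = 2^n ‖e n‖ d n` in `X'`. Comparing `C|f|` with its
values on `(a, s]` shows that `v n` is bounded (`CesaroEmbeds.chi_mem_kotheDual`). Reflexivity makes
`u n` weakly null and `v n` null at every point of `X` (`CesaroEmbeds.tendsto_weakly`,
`CesaroEmbeds.tendsto_pairing_zero`).

The support of `u n` lies immediately to the left of that of `v n`, where averaging still sees it:
both `∫ v n · C (u n)` and `∫ C* (v n) · u n` stay above `1/16` (`CesaroEmbeds.exists_sequences`),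
symmetry being what compares `‖e n‖` with `‖e (n+2)‖`. In `CX` the failing pair is `u n` and `v n ∘
C`; in the Tandori space it is `C* (v n)` and integration against `u n`. -/

/-- A bounded sequence of functionals converges pointwise along every ultrafilter. -/
theorem exists_tendsto_ultrafilter {E : Type*} [NormedAddCommGroup E] [NormedSpace ℝ E]
    (φ : ℕ → StrongDual ℝ E) {M : ℝ} (hM : ∀ n, ‖φ n‖ ≤ M) (U : Ultrafilter ℕ) :
    ∃ Φ : StrongDual ℝ E, ∀ v, Tendsto (fun n => φ n v) U (𝓝 (Φ v)) := by
  -- Banach–Alaoglu. Ultrafilter limits are used because the weak-* compact ball need not be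
  -- sequentially compact.
  have hK := WeakDual.isCompact_closedBall (𝕜 := ℝ) (E := E) 0 M
  obtain ⟨Φ, -, hΦ⟩ := hK.ultrafilter_le_nhds (U.map fun n => StrongDual.toWeakDual (φ n)) (by
    rw [le_principal_iff]
    refine Filter.mem_map.2 (Eventually.of_forall fun n => ?_)
    simpa using hM n)
  refine ⟨WeakDual.toStrongDual Φ, fun v => ?_⟩
  have h : Tendsto (fun n => StrongDual.toWeakDual (φ n)) U (𝓝 Φ) := hΦ
  exact ((WeakDual.eval_continuous v).tendsto Φ).comp h

/-- In a reflexive space, a bounded sequence that converges against a separating set of functionals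
converges weakly. -/
theorem IsReflexiveSpace.tendsto_of_separating {E : Type*} [NormedAddCommGroup E]
    [NormedSpace ℝ E] (hE : IsReflexiveSpace E) {x : ℕ → E} {y : E} {M : ℝ}
    (hM : ∀ n, ‖x n‖ ≤ M) (S : Set (StrongDual ℝ E))
    (hS : ∀ z : E, (∀ s ∈ S, s z = 0) → z = 0)
    (h : ∀ s ∈ S, Tendsto (fun n => s (x n)) atTop (𝓝 (s y))) (ψ : StrongDual ℝ E) :
    Tendsto (fun n => ψ (x n)) atTop (𝓝 (ψ y)) := by
  rw [tendsto_iff_ultrafilter]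
  intro U hU
  -- The limit is taken in the bidual; reflexivity turns it into a point `z`, and `S` forces `z =
  -- y`.
  obtain ⟨Φ, hΦ⟩ := exists_tendsto_ultrafilter
    (fun n => NormedSpace.inclusionInDoubleDual ℝ E (x n))
    (fun n => (NormedSpace.double_dual_bound ℝ E (x n)).trans (hM n)) U
  obtain ⟨z, rfl⟩ := hE Φ
  simp only [NormedSpace.dual_def] at hΦ
  have hzy : z - y = 0 := hS _ fun s hs => by
    rw [map_sub, sub_eq_zero]
    exact tendsto_nhds_unique (hΦ s) ((h s hs).mono_left hU)
  rw [← sub_eq_zero.1 hzy]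
  exact hΦ ψ

/-- If `z k → y` weakly and bounded functionals tend to `0` at each `z k`, then they tend to `0`
at `y`. -/
theorem tendsto_zero_of_weak_approx {E : Type*} [NormedAddCommGroup E] [NormedSpace ℝ E]
    (φ : ℕ → StrongDual ℝ E) {M : ℝ} (hM : ∀ n, ‖φ n‖ ≤ M) {z : ℕ → E} {y : E}
    (hz : ∀ ψ : StrongDual ℝ E, Tendsto (fun n => ψ (z n)) atTop (𝓝 (ψ y)))
    (h : ∀ k, Tendsto (fun n => φ n (z k)) atTop (𝓝 0)) :
    Tendsto (fun n => φ n y) atTop (𝓝 0) := by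
  rw [tendsto_iff_ultrafilter]
  intro U hU
  -- The limit `Φ` is itself a bounded functional, so weak convergence of `z` may be tested on it.
  -- This is why norm convergence of the approximants is not needed.
  obtain ⟨Φ, hΦ⟩ := exists_tendsto_ultrafilter φ hM U
  have h0 : ∀ k, Φ (z k) = 0 := fun k => tendsto_nhds_unique (hΦ (z k)) ((h k).mono_left hU)
  have h1 : Φ y = 0 := by
    refine tendsto_nhds_unique (hz Φ) ?_
    simp only [h0]
    exact tendsto_const_nhds
  rw [← h1]
  exact hΦ y

/-- If `ι : F → E*` is an isometric embedding and `E` is reflexive, then a sequence in `F` whose images are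
null at each point of `E` is weakly null in `F`. -/
theorem IsReflexiveSpace.weakly_null_of_embedding {E F : Type*} [NormedAddCommGroup E]
    [NormedSpace ℝ E] [NormedAddCommGroup F] [NormedSpace ℝ F] (hE : IsReflexiveSpace E)
    (ι : F →ₗᵢ[ℝ] StrongDual ℝ E) {v : ℕ → F}
    (hv : ∀ y, Tendsto (fun n => ι (v n) y) atTop (𝓝 0)) (Φ : StrongDual ℝ F) :
    Tendsto (fun n => Φ (v n)) atTop (𝓝 0) := by
  -- `Φ` is transported to the range of `ι` and extended by Hahn–Banach to all of `E*`; reflexivity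
  -- makes the extension evaluation at some `y`.
  obtain ⟨Ψ, hΨ, -⟩ := exists_extension_norm_eq (LinearMap.range ι.toLinearMap)
    (Φ ∘L (ι.equivRange.symm.toContinuousLinearEquiv : _ →L[ℝ] F))
  obtain ⟨y, rfl⟩ := hE Ψ
  refine (hv y).congr fun n => ?_
  have := hΨ (ι.equivRange (v n))
  simpa using this

/-! ### Preliminaries on ideal spaces -/

section Basic

variable {I : Set ℝ}

/-- The class of the indicator function of `B`. -/
def chi (I : Set ℝ) (B : Set ℝ) (hB : MeasurableSet B) : LZero I :=
  AEEqFun.mk (B.indicator fun _ => (1 : ℝ))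
    (stronglyMeasurable_const.indicator hB).aestronglyMeasurable

theorem coeFn_chi (B : Set ℝ) (hB : MeasurableSet B) :
    chi I B hB =ᵐ[leb I] B.indicator fun _ => (1 : ℝ) :=
  AEEqFun.coeFn_mk _ _

/-- A measurable choice of signs of `f`. -/
def signOf (f : LZero I) : LZero I :=
  AEEqFun.mk (fun x => if 0 ≤ f x then (1 : ℝ) else -1)
    (Measurable.ite (measurableSet_le measurable_const f.measurable) measurable_const
      measurable_const).aestronglyMeasurable

theorem coeFn_signOf (f : LZero I) :
    ∀ᵐ x ∂leb I, |signOf f x| = 1 ∧ signOf f x * f x = |f x| := by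
  filter_upwards [show signOf f =ᵐ[leb I] _ from AEEqFun.coeFn_mk _ _] with x hx
  rw [hx]
  split_ifs with h
  · simp [abs_of_nonneg h]
  · simp [abs_of_neg (not_le.1 h)]

namespace NormedIdealSpace

theorem norm_le_of_abs_le (X : NormedIdealSpace I) {f g : X}
    (h : ∀ᵐ x ∂leb I, |(f : LZero I) x| ≤ |(g : LZero I) x|) : ‖f‖ ≤ ‖g‖ :=
  (X.ideal f g h).2

theorem mem_of_abs_le (X : NormedIdealSpace I) {f g : LZero I} (hg : g ∈ X.toSubmodule)
    (h : ∀ᵐ x ∂leb I, |f x| ≤ |g x|) : f ∈ X.toSubmodule :=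
  (X.ideal f ⟨g, hg⟩ h).1

end NormedIdealSpace

variable [hI : IsBaseInterval I]

theorem IsBaseInterval.Ioc_subset {r s : ℝ} (hr : 0 ≤ r) (hs : s ∈ I) : Ioc r s ⊆ I := by
  rcases hI.eq_or_eq with rfl | rfl
  · exact fun x hx => ⟨hr.trans hx.1.le, hx.2.trans hs.2⟩
  · exact fun x hx => hr.trans hx.1.le

theorem leb_Ioc {r s : ℝ} (hr : 0 ≤ r) (hs : s ∈ I) :
    leb I (Ioc r s) = ENNReal.ofReal (s - r) := by
  rw [Measure.restrict_apply measurableSet_Ioc,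
    inter_eq_left.2 (IsBaseInterval.Ioc_subset hr hs), Real.volume_Ioc]

theorem leb_Ioc_pos {r s : ℝ} (hr : 0 ≤ r) (hrs : r < s) (hs : s ∈ I) : 0 < leb I (Ioc r s) := by
  rw [leb_Ioc hr hs]
  simpa using hrs

theorem chi_Ioc_ne_zero {r s : ℝ} (hr : 0 ≤ r) (hrs : r < s) (hs : s ∈ I) :
    chi I (Ioc r s) measurableSet_Ioc ≠ 0 := by
  intro h
  have h1 := coeFn_chi (I := I) (Ioc r s) measurableSet_Ioc
  rw [h] at h1
  have h2 : ∀ᵐ x ∂leb I, x ∉ Ioc r s := by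
    filter_upwards [h1, AEEqFun.coeFn_zero (α := ℝ) (μ := leb I) (β := ℝ)] with x h3 h4 h5
    rw [h4, indicator_of_mem h5] at h3
    simp at h3
  have h3 : leb I (Ioc r s) = 0 := by
    rw [ae_iff] at h2
    simpa only [not_not, ofPred_mem_eq] using h2
  exact (leb_Ioc_pos hr hrs hs).ne' h3

theorem ae_forall_lt_mem : ∀ᵐ t ∂leb I, ∃ r ∈ I, t < r := by
  rcases hI.eq_or_eq with rfl | rfl
  · rw [leb, ae_restrict_iff' measurableSet_Icc]
    filter_upwards [Measure.ae_ne volume (1 : ℝ)] with t ht htI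
    exact ⟨1, by simp, lt_of_le_of_ne htI.2 ht⟩
  · rw [leb, ae_restrict_iff' measurableSet_Ici]
    exact Eventually.of_forall fun t ht => ⟨t + 1, by simp only [mem_Ici] at *; linarith,
      by linarith⟩

end Basic

/-! ### The pairing between a space and its Köthe dual -/

namespace BanachIdealSpace

variable {I : Set ℝ} (X : BanachIdealSpace I)

/-- Rescale `g` to the unit sphere. The class `f` is arbitrary, so the bound may read `∞`. -/
theorem lintegral_mul_le (f : LZero I) (g : X.toNormedIdealSpace) :
    ∫⁻ x, ‖f x * (g : LZero I) x‖ₑ ∂leb I ≤ ENNReal.ofReal ‖g‖ * X.assocNorm f := by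
  rcases eq_or_ne g 0 with rfl | hg
  · refine le_of_eq_of_le (lintegral_congr_ae (g := 0) ?_) (by simp)
    filter_upwards [AEEqFun.coeFn_zero (α := ℝ) (μ := leb I) (β := ℝ)] with x hx
    simp [hx]
  have hpos : 0 < ‖g‖ := norm_pos_iff.2 hg
  have hle : ‖‖g‖⁻¹ • g‖ ≤ 1 := by
    rw [norm_smul, norm_inv, norm_norm, inv_mul_cancel₀ hpos.ne']
  have h := le_iSup₂_of_le (f := fun (g : X.toNormedIdealSpace) (_ : ‖g‖ ≤ 1) =>
        ∫⁻ x, ‖f x * (g : LZero I) x‖ₑ ∂leb I) _ hle le_rfl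
  change _ ≤ X.assocNorm f at h
  refine le_trans (le_of_eq ?_) (mul_le_mul_right h _)
  rw [← lintegral_const_mul' _ _ ENNReal.ofReal_ne_top]
  refine lintegral_congr_ae ?_
  filter_upwards [AEEqFun.coeFn_smul ‖g‖⁻¹ (g : LZero I)] with x hx
  rw [Submodule.coe_smul, hx, Pi.smul_apply, smul_eq_mul, enorm_mul, enorm_mul, enorm_mul,
    mul_left_comm ‖f x‖ₑ, ← mul_assoc, ← Real.enorm_of_nonneg hpos.le, ← enorm_mul ‖g‖ _,
    mul_inv_cancel₀ hpos.ne', enorm_one, one_mul]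

theorem integrable_mul (f : X.kotheDual) (g : X.toNormedIdealSpace) :
    Integrable (fun x => (f : LZero I) x * (g : LZero I) x) (leb I) :=
  ⟨(f : LZero I).aestronglyMeasurable.mul (g : LZero I).aestronglyMeasurable,
    (X.lintegral_mul_le f g).trans_lt
      (ENNReal.mul_lt_top ENNReal.ofReal_lt_top (lt_top_iff_ne_top.2 f.2))⟩

theorem norm_kotheDual (f : X.kotheDual) : ‖f‖ = (X.assocNorm (f : LZero I)).toReal := rfl

theorem ofReal_norm_kotheDual (f : X.kotheDual) :
    ENNReal.ofReal ‖f‖ = X.assocNorm (f : LZero I) := by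
  rw [norm_kotheDual, ENNReal.ofReal_toReal f.2]

theorem norm_integral_mul_le (f : X.kotheDual) (g : X.toNormedIdealSpace) :
    ‖∫ x, (f : LZero I) x * (g : LZero I) x ∂leb I‖ ≤ ‖f‖ * ‖g‖ := by
  rw [← ENNReal.ofReal_le_ofReal_iff (by positivity), ofReal_norm]
  refine (enorm_integral_le_lintegral_enorm _).trans ((X.lintegral_mul_le f g).trans_eq ?_)
  rw [ENNReal.ofReal_mul (norm_nonneg _), ofReal_norm_kotheDual, mul_comm]

/-- The bilinear pairing `(f, g) ↦ ∫ f g`. -/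
def pairing : X.kotheDual →L[ℝ] StrongDual ℝ X.toNormedIdealSpace :=
  LinearMap.mkContinuous₂
    (LinearMap.mk₂ ℝ (fun (f : X.kotheDual) (g : X.toNormedIdealSpace) =>
        ∫ x, (f : LZero I) x * (g : LZero I) x ∂leb I)
      (fun f₁ f₂ g => by
        rw [← integral_add (X.integrable_mul f₁ g) (X.integrable_mul f₂ g)]
        refine integral_congr_ae ?_
        filter_upwards [AEEqFun.coeFn_add (f₁ : LZero I) f₂] with x hx
        rw [Submodule.coe_add, hx, Pi.add_apply, add_mul])
      (fun c f g => by
        rw [smul_eq_mul, ← integral_const_mul]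
        refine integral_congr_ae ?_
        filter_upwards [AEEqFun.coeFn_smul c (f : LZero I)] with x hx
        rw [Submodule.coe_smul, hx, Pi.smul_apply, smul_eq_mul, mul_assoc])
      (fun f g₁ g₂ => by
        rw [← integral_add (X.integrable_mul f g₁) (X.integrable_mul f g₂)]
        refine integral_congr_ae ?_
        filter_upwards [AEEqFun.coeFn_add (g₁ : LZero I) g₂] with x hx
        rw [Submodule.coe_add, hx, Pi.add_apply, mul_add])
      (fun c f g => by
        rw [smul_eq_mul, ← integral_const_mul]
        refine integral_congr_ae ?_
        filter_upwards [AEEqFun.coeFn_smul c (g : LZero I)] with x hx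
        rw [Submodule.coe_smul, hx, Pi.smul_apply, smul_eq_mul, mul_left_comm]))
    1 (fun f g => by
      rw [one_mul]
      exact X.norm_integral_mul_le f g)

theorem pairing_apply (f : X.kotheDual) (g : X.toNormedIdealSpace) :
    X.pairing f g = ∫ x, (f : LZero I) x * (g : LZero I) x ∂leb I := rfl

/-- The Köthe norm is a supremum of `∫ |f g|`, the operator norm one of `|∫ f g|`. Multiplying `g`
by the sign of `f g` keeps it in the unit ball by the ideal property and turns the first integral
into the second. -/
theorem norm_pairing (f : X.kotheDual) : ‖X.pairing f‖ = ‖f‖ := by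
  refine le_antisymm (ContinuousLinearMap.opNorm_le_bound _ (norm_nonneg _)
    (X.norm_integral_mul_le f)) ?_
  rw [← ENNReal.ofReal_le_ofReal_iff (norm_nonneg _), ofReal_norm_kotheDual]
  refine iSup₂_le fun g hg => ?_
  have hs := coeFn_signOf ((f : LZero I) * (g : LZero I))
  have hm := AEEqFun.coeFn_mul (signOf ((f : LZero I) * (g : LZero I))) (g : LZero I)
  obtain ⟨hmem, hle⟩ := X.ideal (signOf ((f : LZero I) * (g : LZero I)) * (g : LZero I)) g (by
    filter_upwards [hs, hm] with x h1 h2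
    rw [h2, Pi.mul_apply, abs_mul, h1.1, one_mul])
  have h1 : X.pairing f ⟨_, hmem⟩ = ∫ x, ‖(f : LZero I) x * (g : LZero I) x‖ ∂leb I := by
    rw [pairing_apply]
    refine integral_congr_ae ?_
    filter_upwards [hs, hm, AEEqFun.coeFn_mul (f : LZero I) (g : LZero I)] with x h1 h2 h3
    have h4 := h1.2
    rw [h3, Pi.mul_apply] at h4
    rw [h2, Pi.mul_apply, Real.norm_eq_abs, ← h4]
    ring
  rw [← ofReal_integral_norm_eq_lintegral_enorm (X.integrable_mul f g), ← h1]
  refine ENNReal.ofReal_le_ofReal ((le_abs_self _).trans ?_)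
  refine ((X.pairing f).le_opNorm _).trans (mul_le_of_le_one_right (norm_nonneg _) ?_)
  exact hle.trans hg

/-- The pairing as an isometric embedding `X' → X*`. -/
def pairingIsometry : X.kotheDual →ₗᵢ[ℝ] StrongDual ℝ X.toNormedIdealSpace :=
  ⟨X.pairing.toLinearMap, X.norm_pairing⟩

/-- An upper bound of the associated norm gives membership in the Köthe dual. -/
theorem mem_kotheDual_of_le {f : LZero I} {c : ℝ} (hc : 0 ≤ c)
    (h : X.assocNorm f ≤ ENNReal.ofReal c) :
    ∃ hf : f ∈ X.kotheDual.toSubmodule, ‖(⟨f, hf⟩ : X.kotheDual)‖ ≤ c :=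
  ⟨ne_top_of_le_ne_top ENNReal.ofReal_ne_top h, ENNReal.toReal_le_of_le_ofReal hc h⟩

end BanachIdealSpace

/-! ### Consequences of the boundedness of the Cesàro operator -/

section Cesaro

variable {I : Set ℝ} [hI : IsBaseInterval I]

/-- The space `X` is contained in `CX`, with a constant `A`. -/
def CesaroEmbeds (X : NormedIdealSpace I) (A : ℝ) : Prop :=
  0 ≤ A ∧ ∀ f : X, ∃ hf : (f : LZero I) ∈ (cesaroSpace X).toSubmodule,
    ‖(⟨f, hf⟩ : cesaroSpace X)‖ ≤ A * ‖f‖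

theorem NormedIdealSpace.CesaroBounded.exists_embeds {X : NormedIdealSpace I}
    (h : X.CesaroBounded) : ∃ A, CesaroEmbeds X A := by
  obtain ⟨A, hA⟩ := h
  -- The given `A` carries no sign. Boundedness is then applied to `|f|`, since the norm of `CX`
  -- involves `C|f|`.
  refine ⟨max A 0, le_max_right _ _, fun f => ?_⟩
  have hab := AEEqFun.coeFn_abs (f : LZero I)
  obtain ⟨hm, hn⟩ := X.ideal |(f : LZero I)| f (by
    filter_upwards [hab] with x hx
    rw [hx, abs_abs])
  obtain ⟨g, hg, hae⟩ := hA ⟨_, hm⟩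
  have key : ∀ᵐ x ∂leb I, (cesaroOp I).toFun f x ≠ ∞ ∧
      ((cesaroOp I).toFun f x).toReal = (g : LZero I) x := by
    filter_upwards [hae, ae_leb_pos (I := I)] with x hx h0
    have hint : IntegrableOn (fun t => |(f : LZero I) t|) (Ioc 0 x) (leb I) :=
      hx.1.congr (ae_restrict_of_ae hab)
    have hx2 : (g : LZero I) x = x⁻¹ * ∫ t in Ioc 0 x, |(f : LZero I) t| ∂leb I := by
      rw [hx.2]
      congr 1
      exact integral_congr_ae (ae_restrict_of_ae hab)
    have hlt : ∫⁻ t in Ioc 0 x, ‖(f : LZero I) t‖ₑ ∂leb I ≠ ∞ := by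
      have := hint.2
      simp only [HasFiniteIntegral, ← ofReal_norm, Real.norm_eq_abs, abs_abs] at this
      simp only [← ofReal_norm, Real.norm_eq_abs]
      exact this.ne
    refine ⟨ENNReal.div_ne_top hlt (by simpa using h0), ?_⟩
    change ((∫⁻ t in Ioc 0 x, ‖(f : LZero I) t‖ₑ ∂leb I) / ENNReal.ofReal x).toReal = _
    rw [hx2, ENNReal.toReal_div, ENNReal.toReal_ofReal h0.le, div_eq_inv_mul]
    congr 1
    rw [integral_eq_lintegral_of_nonneg_ae (Eventually.of_forall fun _ => abs_nonneg _)
      hint.aestronglyMeasurable]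
    simp only [← Real.enorm_eq_ofReal_abs]
  obtain ⟨h1, h2⟩ := X.ideal ((cesaroOp I).toLZero f) g (by
    filter_upwards [key, (cesaroOp I).coeFn_toLZero f] with x hx h3
    rw [h3, hx.2])
  refine ⟨⟨key.mono fun x hx => hx.1, h1⟩, h2.trans (hg.trans ?_)⟩
  exact mul_le_mul (le_max_left _ _) hn (norm_nonneg _) (le_max_right _ _)

theorem cesaroOp_apply (f : LZero I) (x : ℝ) : (cesaroOp I).toFun f x =
    (∫⁻ t in Ioc 0 x, ‖f t‖ₑ ∂leb I) / ENNReal.ofReal x := rfl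

theorem le_cesaroOp (f : LZero I) {a s x : ℝ} (hx : x ∈ Ioc a s) :
    (∫⁻ t in Ioc 0 a, ‖f t‖ₑ ∂leb I) / ENNReal.ofReal s ≤ (cesaroOp I).toFun f x := by
  rw [cesaroOp_apply]
  exact ENNReal.div_le_div (lintegral_mono_set (Ioc_subset_Ioc_right hx.1.le))
    (ENNReal.ofReal_le_ofReal hx.2)

variable {X : BanachIdealSpace I} {A : ℝ}

/-- An infinite integral over `(0, a]` would make `C|f|` infinite on `(a, s]`, a set of positive
measure. -/
theorem CesaroEmbeds.lintegral_ne_top (hA : CesaroEmbeds X.toNormedIdealSpace A)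
    (f : X.toNormedIdealSpace) {a s : ℝ} (ha : 0 ≤ a) (has : a < s) (hs : s ∈ I) :
    ∫⁻ t in Ioc 0 a, ‖(f : LZero I) t‖ₑ ∂leb I ≠ ∞ := by
  intro htop
  obtain ⟨hf, -⟩ := hA.2 f
  have h2 : ∀ᵐ x ∂leb I, x ∉ Ioc a s := by
    filter_upwards [hf.1] with x hx hxs
    have := le_cesaroOp (f : LZero I) hxs
    rw [htop, ENNReal.top_div_of_ne_top ENNReal.ofReal_ne_top, top_le_iff] at this
    exact hx this
  rw [ae_iff] at h2
  simp only [not_not, ofPred_mem_eq] at h2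
  exact (leb_Ioc_pos ha has hs).ne' h2

/-- On `(a, s]` the average `C|f|` is at least `s⁻¹ ∫₀ᵃ |f|`, so the ideal property applies. -/
theorem CesaroEmbeds.smul_chi_mem (hA : CesaroEmbeds X.toNormedIdealSpace A)
    (f : X.toNormedIdealSpace) {a s : ℝ} (ha : 0 ≤ a) (has : a < s) :
    ∃ h : ((∫⁻ t in Ioc 0 a, ‖(f : LZero I) t‖ₑ ∂leb I).toReal / s) •
        chi I (Ioc a s) measurableSet_Ioc ∈ X.toSubmodule,
      ‖(⟨_, h⟩ : X.toNormedIdealSpace)‖ ≤ A * ‖f‖ := by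
  obtain ⟨hf, hn⟩ := hA.2 f
  have hspos := ha.trans_lt has
  obtain ⟨h1, h2⟩ := X.ideal (((∫⁻ t in Ioc 0 a, ‖(f : LZero I) t‖ₑ ∂leb I).toReal / s) •
        chi I (Ioc a s) measurableSet_Ioc) ⟨_, hf.2⟩ (by
    filter_upwards [coeFn_chi (I := I) (Ioc a s) measurableSet_Ioc, hf.1,
      (cesaroOp I).coeFn_toLZero f, AEEqFun.coeFn_smul
        ((∫⁻ t in Ioc 0 a, ‖(f : LZero I) t‖ₑ ∂leb I).toReal / s)
        (chi I (Ioc a s) measurableSet_Ioc)] with x h1 h2 h3 h4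
    rw [h3, h4, Pi.smul_apply, h1]
    by_cases hx : x ∈ Ioc a s
    · have h5 := ENNReal.toReal_mono h2 (le_cesaroOp (f : LZero I) hx)
      rw [ENNReal.toReal_div, ENNReal.toReal_ofReal hspos.le] at h5
      rw [indicator_of_mem hx, smul_eq_mul, mul_one, abs_of_nonneg (by positivity)]
      exact h5.trans (le_abs_self _)
    · simp [indicator_of_notMem hx])
  exact ⟨h1, h2.trans hn⟩

/-- For a weak unit the coefficient in `CesaroEmbeds.smul_chi_mem` is finite and positive, and can
be divided out. -/
theorem CesaroEmbeds.chi_mem (hA : CesaroEmbeds X.toNormedIdealSpace A)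
    {a s : ℝ} (ha : 0 < a) (has : a < s) (hs : s ∈ I) :
    chi I (Ioc a s) measurableSet_Ioc ∈ X.toSubmodule := by
  obtain ⟨w, hw⟩ := X.weakUnit
  obtain ⟨h, -⟩ := hA.smul_chi_mem w ha.le has
  have haI : a ∈ I := IsBaseInterval.Ioc_subset le_rfl hs ⟨ha, has.le⟩
  have hpos : 0 < (∫⁻ t in Ioc 0 a, ‖(w : LZero I) t‖ₑ ∂leb I).toReal := by
    refine ENNReal.toReal_pos (fun h0 => ?_) (hA.lintegral_ne_top w ha.le has hs)
    rw [lintegral_eq_zero_iff' (w : LZero I).aestronglyMeasurable.enorm.restrict,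
      EventuallyEq, ae_restrict_iff' measurableSet_Ioc] at h0
    have h2 : ∀ᵐ x ∂leb I, x ∉ Ioc 0 a := by
      filter_upwards [h0, hw] with x h1 h2 h3
      have := h1 h3
      simp only [Pi.zero_apply, enorm_eq_zero] at this
      exact h2.ne' this
    rw [ae_iff] at h2
    simp only [not_not, ofPred_mem_eq] at h2
    exact (leb_Ioc_pos le_rfl ha haI).ne' h2
  have := X.toSubmodule.smul_mem
    ((∫⁻ t in Ioc 0 a, ‖(w : LZero I) t‖ₑ ∂leb I).toReal / s)⁻¹ h
  rwa [smul_smul, inv_mul_cancel₀ (div_pos hpos (ha.trans has)).ne', one_smul] at this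

/-- Read over all `f` in the unit ball, this bounds the `X'`-norm of the indicator of `(0, a]` by a
multiple of the reciprocal of the `X`-norm of the indicator of `(a, s]`. -/
theorem CesaroEmbeds.lintegral_mul_norm_le (hA : CesaroEmbeds X.toNormedIdealSpace A)
    (f : X.toNormedIdealSpace) {a s : ℝ} (ha : 0 < a) (has : a < s) (hs : s ∈ I) :
    (∫⁻ t in Ioc 0 a, ‖(f : LZero I) t‖ₑ ∂leb I).toReal *
      ‖(⟨_, hA.chi_mem ha has hs⟩ : X.toNormedIdealSpace)‖ ≤ s * A * ‖f‖ := by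
  obtain ⟨h, hn⟩ := hA.smul_chi_mem f ha.le has
  have hspos := ha.trans has
  have : (⟨_, h⟩ : X.toNormedIdealSpace) =
      ((∫⁻ t in Ioc 0 a, ‖(f : LZero I) t‖ₑ ∂leb I).toReal / s) •
        (⟨_, hA.chi_mem ha has hs⟩ : X.toNormedIdealSpace) := rfl
  rw [this, norm_smul, Real.norm_of_nonneg (by positivity), div_mul_eq_mul_div,
    div_le_iff₀ hspos] at hn
  linarith

theorem CesaroEmbeds.norm_chi_pos (hA : CesaroEmbeds X.toNormedIdealSpace A)
    {a s : ℝ} (ha : 0 < a) (has : a < s) (hs : s ∈ I) :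
    0 < ‖(⟨_, hA.chi_mem ha has hs⟩ : X.toNormedIdealSpace)‖ :=
  norm_pos_iff.2 fun h => chi_Ioc_ne_zero ha.le has hs (congrArg Subtype.val h)

/-- Indicator functions of intervals near `0` belong to the Köthe dual. -/
theorem CesaroEmbeds.chi_mem_kotheDual (hA : CesaroEmbeds X.toNormedIdealSpace A)
    {a s : ℝ} (ha : 0 < a) (has : a < s) (hs : s ∈ I) :
    ∃ h : chi I (Ioc 0 a) measurableSet_Ioc ∈ X.kotheDual.toSubmodule,
      ‖(⟨_, h⟩ : X.kotheDual)‖ ≤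
        s * A / ‖(⟨_, hA.chi_mem ha has hs⟩ : X.toNormedIdealSpace)‖ := by
  have hA0 := hA.1
  have hspos := ha.trans has
  have hn := hA.norm_chi_pos ha has hs
  refine X.mem_kotheDual_of_le (by positivity) (iSup₂_le fun g hg => ?_)
  have h1 : ∫⁻ x, ‖chi I (Ioc 0 a) measurableSet_Ioc x * (g : LZero I) x‖ₑ ∂leb I =
      ∫⁻ t in Ioc 0 a, ‖(g : LZero I) t‖ₑ ∂leb I := by
    rw [← lintegral_indicator measurableSet_Ioc]
    refine lintegral_congr_ae ?_
    filter_upwards [coeFn_chi (I := I) (Ioc 0 a) measurableSet_Ioc] with x hx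
    rw [hx]
    by_cases h : x ∈ Ioc 0 a <;> simp [h]
  rw [h1, ← ENNReal.ofReal_toReal (hA.lintegral_ne_top g ha.le has hs)]
  refine ENNReal.ofReal_le_ofReal ?_
  rw [le_div_iff₀ hn]
  refine (hA.lintegral_mul_norm_le g ha has hs).trans ?_
  exact mul_le_of_le_one_right (by positivity) hg

end Cesaro

/-! ### Weak convergence in ideal spaces -/

section Weak

variable {I : Set ℝ} [hI : IsBaseInterval I] {X : BanachIdealSpace I} {A : ℝ}

/-- Elements of the Köthe dual vanishing near `0` separate the points of `X`. -/
theorem CesaroEmbeds.eq_zero_of_pairing (hA : CesaroEmbeds X.toNormedIdealSpace A)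
    (z : X.toNormedIdealSpace)
    (h : ∀ g : X.kotheDual, (∃ a > 0, ∀ᵐ x ∂leb I, x ≤ a → (g : LZero I) x = 0) →
      X.pairing g z = 0) : z = 0 := by
  have key : ∀ q r : ℚ, 0 < (q : ℝ) → (q : ℝ) < r → (∃ s ∈ I, (r : ℝ) < s) →
      ∀ᵐ t ∂leb I, t ∈ Ioc (q : ℝ) r → (z : LZero I) t = 0 := by
    rintro q r hq hqr ⟨s, hs, hrs⟩
    obtain ⟨hm, -⟩ := hA.chi_mem_kotheDual (hq.trans hqr) hrs hs
    have hsg := coeFn_signOf (z : LZero I)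
    have hmul := AEEqFun.coeFn_mul (signOf (z : LZero I))
      (chi I (Ioc (q : ℝ) r) measurableSet_Ioc)
    have hc := coeFn_chi (I := I) (Ioc (q : ℝ) r) measurableSet_Ioc
    -- Test function: paired with `z` it gives the integral of `|z|` over `(q, r]`. It lies in `X'`
    -- because it is dominated by the indicator of `(0, r]`, which requires a point of `I` beyond
    -- `r`.
    have hg : signOf (z : LZero I) * chi I (Ioc (q : ℝ) r) measurableSet_Ioc ∈
        X.kotheDual.toSubmodule := by
      refine X.kotheDual.mem_of_abs_le hm ?_
      filter_upwards [hsg, hmul, hc, coeFn_chi (I := I) (Ioc 0 (r : ℝ)) measurableSet_Ioc]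
        with x h1 h2 h3 h4
      rw [h2, Pi.mul_apply, abs_mul, h1.1, one_mul, h3, h4]
      by_cases hx : x ∈ Ioc (q : ℝ) r
      · rw [indicator_of_mem hx, indicator_of_mem (show x ∈ Ioc 0 (r : ℝ) from ⟨hq.trans hx.1, hx.2⟩)]
      · simp [indicator_of_notMem hx]
    have h0 := h ⟨_, hg⟩ ⟨q, hq, by
      filter_upwards [hmul, hc] with x h2 h3 hx
      rw [h2, Pi.mul_apply, h3, indicator_of_notMem (fun h => absurd hx (not_le.2 h.1)),
        mul_zero]⟩
    have hint := X.integrable_mul ⟨_, hg⟩ z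
    rw [BanachIdealSpace.pairing_apply] at h0
    have hae : ∀ᵐ x ∂leb I, (signOf (z : LZero I) * chi I (Ioc (q : ℝ) r) measurableSet_Ioc :
        LZero I) x * (z : LZero I) x = (Ioc (q : ℝ) r).indicator (fun t => |(z : LZero I) t|) x := by
      filter_upwards [hsg, hmul, hc] with x h1 h2 h3
      rw [h2, Pi.mul_apply, h3]
      by_cases hx : x ∈ Ioc (q : ℝ) r
      · rw [indicator_of_mem hx, indicator_of_mem hx, mul_one, h1.2]
      · simp [indicator_of_notMem hx]
    rw [integral_eq_zero_iff_of_nonneg_ae _ hint] at h0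
    · filter_upwards [h0, hae] with x h1 h2 hx
      rw [h1, indicator_of_mem hx] at h2
      exact abs_eq_zero.1 h2.symm
    · filter_upwards [hae] with x h2
      rw [h2]
      exact indicator_nonneg (fun _ _ => abs_nonneg _) x
  have hall : ∀ᵐ t ∂leb I, ∀ q r : ℚ, 0 < (q : ℝ) → (q : ℝ) < r → (∃ s ∈ I, (r : ℝ) < s) →
      t ∈ Ioc (q : ℝ) r → (z : LZero I) t = 0 := by
    rw [ae_all_iff]
    intro q
    rw [ae_all_iff]
    intro r
    by_cases hq : 0 < (q : ℝ) ∧ (q : ℝ) < r ∧ ∃ s ∈ I, (r : ℝ) < s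
    · filter_upwards [key q r hq.1 hq.2.1 hq.2.2] with t ht _ _ _ using ht
    · exact Eventually.of_forall fun t h1 h2 h3 => absurd ⟨h1, h2, h3⟩ hq
  refine Subtype.ext (AEEqFun.ext ?_)
  filter_upwards [hall, ae_forall_lt_mem (I := I), ae_leb_pos (I := I),
    AEEqFun.coeFn_zero (α := ℝ) (μ := leb I) (β := ℝ)] with t h1 h2 h3 h4
  obtain ⟨s, hs, hts⟩ := h2
  obtain ⟨q, hq1, hq2⟩ := exists_rat_btwn h3
  obtain ⟨r, hr1, hr2⟩ := exists_rat_btwn hts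
  rw [h1 q r hq1 (hq2.trans hr1) ⟨s, hs, hr2⟩ ⟨hq2, hr1.le⟩]
  exact h4.symm

/-- A bounded sequence converges weakly as soon as it is eventually constant away from `0`. -/
theorem CesaroEmbeds.tendsto_weakly (hA : CesaroEmbeds X.toNormedIdealSpace A)
    (hX : IsReflexiveSpace X.toNormedIdealSpace) {u : ℕ → X.toNormedIdealSpace}
    {y : X.toNormedIdealSpace} {M : ℝ} (hM : ∀ n, ‖u n‖ ≤ M)
    (h : ∀ a > 0, ∀ᶠ n in atTop, ∀ᵐ x ∂leb I, a < x → (u n : LZero I) x = (y : LZero I) x)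
    (ψ : StrongDual ℝ X.toNormedIdealSpace) :
    Tendsto (fun n => ψ (u n)) atTop (𝓝 (ψ y)) := by
  refine hX.tendsto_of_separating hM (X.pairing '' {g : X.kotheDual |
    ∃ a > 0, ∀ᵐ x ∂leb I, x ≤ a → (g : LZero I) x = 0}) (fun z hz => ?_) ?_ ψ
  · exact hA.eq_zero_of_pairing z fun g hg => hz _ ⟨g, hg, rfl⟩
  · rintro _ ⟨g, ⟨a, ha, hg⟩, rfl⟩
    refine tendsto_const_nhds.congr' ?_
    filter_upwards [h a ha] with n hn
    rw [BanachIdealSpace.pairing_apply, BanachIdealSpace.pairing_apply]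
    refine integral_congr_ae ?_
    filter_upwards [hn, hg] with x h1 h2
    rcases le_or_gt x a with hx | hx
    · simp [h2 hx]
    · rw [h1 hx]

/-- A bounded sequence in the Köthe dual whose supports shrink to `0` is null at every point
of `X`. -/
theorem CesaroEmbeds.tendsto_pairing_zero (hA : CesaroEmbeds X.toNormedIdealSpace A)
    (hX : IsReflexiveSpace X.toNormedIdealSpace) {v : ℕ → X.kotheDual} {M : ℝ}
    (hM : ∀ n, ‖v n‖ ≤ M)
    (h : ∀ a > 0, ∀ᶠ n in atTop, ∀ᵐ x ∂leb I, a < x → (v n : LZero I) x = 0)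
    (f : X.toNormedIdealSpace) :
    Tendsto (fun n => X.pairing (v n) f) atTop (𝓝 0) := by
  have hmul := fun k : ℕ => AEEqFun.coeFn_mul (f : LZero I)
    (chi I (Ioi (1 / ((k : ℝ) + 1))) measurableSet_Ioi)
  have hc := fun k : ℕ => coeFn_chi (I := I) (Ioi (1 / ((k : ℝ) + 1))) measurableSet_Ioi
  -- Truncations of `f` away from `0` are bounded by `‖f‖` and converge weakly to `f`; each is
  -- eventually disjoint from the support of `v n`.
  have hex := fun k : ℕ => X.ideal ((f : LZero I) *
      chi I (Ioi (1 / ((k : ℝ) + 1))) measurableSet_Ioi) f (by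
    filter_upwards [hmul k, hc k] with x h1 h2
    rw [h1, Pi.mul_apply, h2]
    by_cases hx : x ∈ Ioi (1 / ((k : ℝ) + 1))
    · rw [indicator_of_mem hx, mul_one]
    · rw [indicator_of_notMem hx, mul_zero, abs_zero]
      exact abs_nonneg _)
  choose hmem hle using hex
  refine tendsto_zero_of_weak_approx (fun n => X.pairing (v n)) (M := M)
    (fun n => (X.norm_pairing _).trans_le (hM n)) (z := fun k => ⟨_, hmem k⟩)
    (hA.tendsto_weakly hX hle fun a ha => ?_) fun k => ?_
  · filter_upwards [(tendsto_one_div_add_atTop_nhds_zero_nat (𝕜 := ℝ)).eventually_lt_const ha]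
      with k hk
    filter_upwards [hmul k, hc k] with x h1 h2 hx
    rw [h1, Pi.mul_apply, h2, indicator_of_mem (show x ∈ Ioi _ from hk.trans hx), mul_one]
  · refine tendsto_const_nhds.congr' ?_
    filter_upwards [h (1 / ((k : ℝ) + 1)) (by positivity)] with n hn
    rw [BanachIdealSpace.pairing_apply]
    symm
    refine integral_eq_zero_of_ae ?_
    filter_upwards [hn, hmul k, hc k] with x h1 h2 h3
    by_cases hx : x ∈ Ioi (1 / ((k : ℝ) + 1))
    · simp [h1 hx]
    · simp only [h2, Pi.mul_apply, h3, indicator_of_notMem hx, mul_zero, Pi.zero_apply]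

end Weak

/-! ### The Cesàro and Copson operators as bounded maps -/

section Classes

variable {I : Set ℝ}

/-- The function `C*|f|` with values in `[0, ∞]`. -/
def copsonLintegral (f : LZero I) (x : ℝ) : ℝ≥0∞ := ∫⁻ t in Ici x, ‖f t / t‖ₑ ∂leb I

theorem copsonLintegral_antitone (f : LZero I) : Antitone (copsonLintegral f) :=
  fun _ _ hxy => lintegral_mono_set (Ici_subset_Ici.2 hxy)

/-- The variable domain is moved into the integrand as an indicator, jointly measurable in both
variables. The same device serves `stronglyMeasurable_cesaro`. -/
theorem stronglyMeasurable_copson (f : LZero I) :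
    StronglyMeasurable fun x : ℝ => ∫ t in Ici x, f t / t ∂leb I := by
  have h : StronglyMeasurable
      (Function.uncurry fun x t : ℝ => (Ici x).indicator (fun t => f t / t) t) := by
    have hS : MeasurableSet {p : ℝ × ℝ | p.1 ≤ p.2} := measurableSet_le measurable_fst measurable_snd
    exact (((f.measurable.comp measurable_snd).div measurable_snd).indicator hS).stronglyMeasurable
  have := h.integral_prod_right (ν := leb I)
  simpa only [Function.uncurry_apply_pair, integral_indicator measurableSet_Ici] using this

theorem integrableOn_of_copsonLintegral_ne_top {f : LZero I} {x : ℝ}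
    (h : copsonLintegral f x ≠ ∞) : IntegrableOn (fun t => f t / t) (Ici x) (leb I) :=
  ⟨(f.measurable.div measurable_id).aestronglyMeasurable, lt_top_iff_ne_top.2 h⟩

theorem stronglyMeasurable_cesaro (f : LZero I) :
    StronglyMeasurable fun x : ℝ => x⁻¹ * ∫ t in Ioc 0 x, f t ∂leb I := by
  refine StronglyMeasurable.mul measurable_inv.stronglyMeasurable ?_
  have h : StronglyMeasurable
      (Function.uncurry fun x t : ℝ => (Ioc 0 x).indicator (fun t => f t) t) := by
    have hS : MeasurableSet {p : ℝ × ℝ | 0 < p.2 ∧ p.2 ≤ p.1} :=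
      (measurableSet_lt measurable_const measurable_snd).inter
        (measurableSet_le measurable_snd measurable_fst)
    exact (f.stronglyMeasurable.comp_measurable measurable_snd).indicator hS
  have := h.integral_prod_right (ν := leb I)
  simpa only [Function.uncurry_apply_pair, integral_indicator measurableSet_Ioc] using this

/-- The class of `Cf`. -/
def cesaroFun (f : LZero I) : LZero I :=
  AEEqFun.mk (fun x : ℝ => x⁻¹ * ∫ t in Ioc 0 x, f t ∂leb I)
    (stronglyMeasurable_cesaro f).aestronglyMeasurable

theorem coeFn_cesaroFun (f : LZero I) :
    ∀ᵐ x ∂leb I, cesaroFun f x = x⁻¹ * ∫ t in Ioc 0 x, f t ∂leb I :=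
  AEEqFun.coeFn_mk _ _

/-- The class of `C*|f|`. -/
def copsonAbs (f : LZero I) : LZero I :=
  AEEqFun.mk (fun x => (copsonLintegral f x).toReal)
    (copsonLintegral_antitone f).measurable.ennreal_toReal.aestronglyMeasurable

theorem coeFn_copsonAbs (f : LZero I) :
    ∀ᵐ x ∂leb I, copsonAbs f x = (copsonLintegral f x).toReal :=
  AEEqFun.coeFn_mk _ _

/-- The class of `C*f`. -/
def copsonFun (f : LZero I) : LZero I :=
  AEEqFun.mk (fun x : ℝ => ∫ t in Ici x, f t / t ∂leb I)
    (stronglyMeasurable_copson f).aestronglyMeasurable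

theorem coeFn_copsonFun (f : LZero I) :
    ∀ᵐ x ∂leb I, copsonFun f x = ∫ t in Ici x, f t / t ∂leb I :=
  AEEqFun.coeFn_mk _ _

end Classes

/-! ### The factorizations `X → CX → X` and `X' → X'~ → X'` -/

section Maps

variable {I : Set ℝ} [hI : IsBaseInterval I] {X : BanachIdealSpace I} {A : ℝ}

/-- The embedding `X → CX`. -/
def CesaroEmbeds.embedding (hA : CesaroEmbeds X.toNormedIdealSpace A) :
    X.toNormedIdealSpace →L[ℝ] cesaroSpace X.toNormedIdealSpace :=
  LinearMap.mkContinuous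
    { toFun := fun f => ⟨f, (hA.2 f).1⟩
      map_add' := fun _ _ => rfl
      map_smul' := fun _ _ => rfl } A fun f => (hA.2 f).2

theorem CesaroEmbeds.coe_embedding (hA : CesaroEmbeds X.toNormedIdealSpace A)
    (f : X.toNormedIdealSpace) : (hA.embedding f : LZero I) = f := rfl

theorem integrableOn_of_cesaroOp_ne_top {f : LZero I} {x : ℝ}
    (h : (cesaroOp I).toFun f x ≠ ∞) : IntegrableOn f (Ioc 0 x) (leb I) := by
  refine ⟨f.aestronglyMeasurable.restrict, lt_top_iff_ne_top.2 fun htop => h ?_⟩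
  rw [cesaroOp_apply, htop, ENNReal.top_div_of_ne_top ENNReal.ofReal_ne_top]

theorem abs_cesaro_le {f : LZero I} {x : ℝ} (hx : 0 < x) (h : (cesaroOp I).toFun f x ≠ ∞) :
    |x⁻¹ * ∫ t in Ioc 0 x, f t ∂leb I| ≤ ((cesaroOp I).toFun f x).toReal := by
  have h1 := integrableOn_of_cesaroOp_ne_top h
  rw [cesaroOp_apply, ENNReal.toReal_div, ENNReal.toReal_ofReal hx.le, abs_mul,
    abs_of_pos (inv_pos.2 hx), div_eq_inv_mul]
  refine mul_le_mul_of_nonneg_left ?_ (inv_pos.2 hx).le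
  rw [← Real.norm_eq_abs, ← toReal_enorm]
  exact ENNReal.toReal_mono h1.2.ne (enorm_integral_le_lintegral_enorm _)

/-- Pointwise `|Cf| ≤ C|f|`, and the norm of `CX` is the norm of the right-hand side. -/
theorem cesaroFun_mem (X : NormedIdealSpace I) (f : cesaroSpace X) :
    ∃ h : cesaroFun (f : LZero I) ∈ X.toSubmodule, ‖(⟨_, h⟩ : X)‖ ≤ ‖f‖ := by
  refine X.ideal _ ⟨_, f.2.2⟩ ?_
  filter_upwards [coeFn_cesaroFun (f : LZero I), f.2.1, ae_leb_pos (I := I),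
    (cesaroOp I).coeFn_toLZero (f : LZero I)] with x h1 h2 h3 h4
  rw [h1, h4]
  exact (abs_cesaro_le h3 h2).trans (le_abs_self _)

/-- The Cesàro operator as a contraction `CX → X`. -/
def cesaroMap (X : NormedIdealSpace I) : cesaroSpace X →L[ℝ] X :=
  LinearMap.mkContinuous
    { toFun := fun f => ⟨_, (cesaroFun_mem X f).1⟩
      map_add' := fun f g => Subtype.ext (AEEqFun.ext (by
        simp only [Submodule.coe_add]
        filter_upwards [coeFn_cesaroFun (f : LZero I), coeFn_cesaroFun (g : LZero I),
          coeFn_cesaroFun ((f : LZero I) + (g : LZero I)), f.2.1, g.2.1,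
          AEEqFun.coeFn_add (cesaroFun (f : LZero I)) (cesaroFun (g : LZero I))] with x h1 h2 h3 h4 h5 h6
        rw [h6, Pi.add_apply, h1, h2, h3, ← mul_add,
          ← integral_add (integrableOn_of_cesaroOp_ne_top h4) (integrableOn_of_cesaroOp_ne_top h5)]
        congr 1
        exact integral_congr_ae (ae_restrict_of_ae (AEEqFun.coeFn_add (f : LZero I) g))))
      map_smul' := fun c f => Subtype.ext (AEEqFun.ext (by
        simp only [Submodule.coe_smul, RingHom.id_apply]
        filter_upwards [coeFn_cesaroFun (f : LZero I), coeFn_cesaroFun (c • (f : LZero I)),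
          AEEqFun.coeFn_smul c (cesaroFun (f : LZero I))] with x h1 h2 h3
        rw [h3, Pi.smul_apply, h1, h2, smul_eq_mul, mul_left_comm, ← integral_const_mul c]
        congr 1
        exact integral_congr_ae (ae_restrict_of_ae (AEEqFun.coeFn_smul c (f : LZero I))))) }
    1 fun f => by
      rw [one_mul]
      exact (cesaroFun_mem X f).2

theorem coe_cesaroMap (X : NormedIdealSpace I) (f : cesaroSpace X) :
    (cesaroMap X f : LZero I) = cesaroFun f := rfl

/-- Tonelli's theorem: `C` and `C*` are adjoint to each other. -/
theorem lintegral_copson_mul (f g : LZero I) :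
    ∫⁻ x, copsonLintegral f x * ‖g x‖ₑ ∂leb I =
      ∫⁻ t, ‖f t‖ₑ * (cesaroOp I).toFun g t ∂leb I := by
  have hmeas : Measurable (Function.uncurry fun x t : ℝ =>
      (Ici x).indicator (fun t => ‖f t / t‖ₑ * ‖g x‖ₑ) t) := by
    have hS : MeasurableSet {p : ℝ × ℝ | p.1 ≤ p.2} := measurableSet_le measurable_fst measurable_snd
    exact (((f.measurable.comp measurable_snd).div measurable_snd).enorm.mul
      (g.measurable.comp measurable_fst).enorm).indicator hS
  have h1 : ∀ x, copsonLintegral f x * ‖g x‖ₑ =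
      ∫⁻ t, (Ici x).indicator (fun t => ‖f t / t‖ₑ * ‖g x‖ₑ) t ∂leb I := fun x => by
    rw [lintegral_indicator measurableSet_Ici, copsonLintegral,
      lintegral_mul_const' _ _ enorm_ne_top]
  simp only [h1]
  rw [lintegral_lintegral_swap hmeas.aemeasurable]
  refine lintegral_congr_ae ?_
  filter_upwards [ae_leb_pos (I := I)] with t ht
  -- For `x > 0` the conditions `t ∈ [x, ∞)` and `x ∈ (0, t]` coincide.
  have h2 : ∫⁻ x, (Ici x).indicator (fun t => ‖f t / t‖ₑ * ‖g x‖ₑ) t ∂leb I =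
      ∫⁻ x, ‖f t / t‖ₑ * (Ioc 0 t).indicator (fun x => ‖g x‖ₑ) x ∂leb I := by
    refine lintegral_congr_ae ?_
    filter_upwards [ae_leb_pos (I := I)] with x hx
    by_cases hxt : x ≤ t
    · rw [indicator_of_mem (show t ∈ Ici x from hxt),
        indicator_of_mem (show x ∈ Ioc 0 t from ⟨hx, hxt⟩)]
    · rw [indicator_of_notMem (show t ∉ Ici x from hxt), indicator_of_notMem fun h => hxt h.2,
        mul_zero]
  rw [h2, lintegral_const_mul' _ _ enorm_ne_top, lintegral_indicator measurableSet_Ioc,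
    cesaroOp_apply, div_eq_mul_inv (f t), enorm_mul, enorm_inv ht.ne', Real.enorm_of_nonneg ht.le,
    div_eq_mul_inv, mul_assoc, mul_comm (ENNReal.ofReal t)⁻¹]

/-- By Tonelli the left side is `∫ |f| C|g|`, and `C|g|` has norm at most `A ‖g‖` in `X`. -/
theorem CesaroEmbeds.lintegral_copson_mul_le (hA : CesaroEmbeds X.toNormedIdealSpace A)
    (f : LZero I) (g : X.toNormedIdealSpace) :
    ∫⁻ x, copsonLintegral f x * ‖(g : LZero I) x‖ₑ ∂leb I ≤
      ENNReal.ofReal (A * ‖g‖) * X.assocNorm f := by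
  obtain ⟨hg, hn⟩ := hA.2 g
  rw [lintegral_copson_mul]
  have h := X.lintegral_mul_le f ⟨_, hg.2⟩
  refine le_trans (lintegral_mono_ae ?_) (h.trans (mul_le_mul_left (ENNReal.ofReal_le_ofReal hn) _))
  filter_upwards [hg.1, (cesaroOp I).coeFn_toLZero (g : LZero I)] with x h1 h2
  rw [enorm_mul, h2, Real.enorm_of_nonneg ENNReal.toReal_nonneg, ENNReal.ofReal_toReal h1]

/-- Paired with a weak unit, `C*|f|` has a finite integral, so it is finite wherever the unit is
positive. -/
theorem CesaroEmbeds.copsonLintegral_ne_top (hA : CesaroEmbeds X.toNormedIdealSpace A)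
    (f : X.kotheDual) : ∀ᵐ x ∂leb I, copsonLintegral (f : LZero I) x ≠ ∞ := by
  obtain ⟨w, hw⟩ := X.weakUnit
  have h := (hA.lintegral_copson_mul_le (f : LZero I) w).trans_lt
    (ENNReal.mul_lt_top ENNReal.ofReal_lt_top (lt_top_iff_ne_top.2 f.2))
  have hm : AEMeasurable (fun x => copsonLintegral (f : LZero I) x * ‖(w : LZero I) x‖ₑ) (leb I) :=
    (copsonLintegral_antitone _).measurable.aemeasurable.mul (w : LZero I).measurable.enorm.aemeasurable
  filter_upwards [ae_lt_top' hm h.ne, hw] with x h1 h2 h3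
  rw [h3, ENNReal.top_mul (by simpa using h2.ne')] at h1
  exact lt_irrefl _ h1

/-- Boundedness of `C` on `X` passes to its adjoint `C*` on `X'` with the same constant. -/
theorem CesaroEmbeds.copsonAbs_mem (hA : CesaroEmbeds X.toNormedIdealSpace A)
    (f : X.kotheDual) : ∃ h : copsonAbs (f : LZero I) ∈ X.kotheDual.toSubmodule,
      ‖(⟨_, h⟩ : X.kotheDual)‖ ≤ A * ‖f‖ := by
  refine X.mem_kotheDual_of_le (mul_nonneg hA.1 (norm_nonneg _)) (iSup₂_le fun g hg => ?_)
  have h1 : ∫⁻ x, ‖copsonAbs (f : LZero I) x * (g : LZero I) x‖ₑ ∂leb I =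
      ∫⁻ x, copsonLintegral (f : LZero I) x * ‖(g : LZero I) x‖ₑ ∂leb I := by
    refine lintegral_congr_ae ?_
    filter_upwards [coeFn_copsonAbs (f : LZero I), hA.copsonLintegral_ne_top f] with x h2 h3
    rw [enorm_mul, h2, Real.enorm_of_nonneg ENNReal.toReal_nonneg, ENNReal.ofReal_toReal h3]
  rw [h1, ENNReal.ofReal_mul hA.1, X.ofReal_norm_kotheDual]
  refine (hA.lintegral_copson_mul_le (f : LZero I) g).trans (mul_le_mul_left ?_ _)
  exact ENNReal.ofReal_le_ofReal (mul_le_of_le_one_right hA.1 hg)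

theorem majorantOp_apply (f : LZero I) (x : ℝ) : (majorantOp I).toFun f x =
    essSup (fun t => ‖f t‖ₑ) ((leb I).restrict (Ici x)) := rfl

/-- `C*|f|` is decreasing and dominates `|C*f|`, hence also the least decreasing majorant of it.
This is what places `C*f` in the Tandori space and not merely in `X'`. -/
theorem majorantOp_copsonFun_le (f : LZero I) (x : ℝ) :
    (majorantOp I).toFun (copsonFun f) x ≤ copsonLintegral f x := by
  rw [majorantOp_apply]
  refine essSup_le_of_ae_le _ ?_
  filter_upwards [ae_restrict_of_ae (coeFn_copsonFun f), ae_restrict_mem measurableSet_Ici]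
    with t h1 h2
  rw [h1]
  exact (enorm_integral_le_lintegral_enorm _).trans (copsonLintegral_antitone f h2)

theorem CesaroEmbeds.copsonFun_mem (hA : CesaroEmbeds X.toNormedIdealSpace A)
    (f : X.kotheDual) : ∃ h : copsonFun (f : LZero I) ∈ (tandoriSpace X.kotheDual).toSubmodule,
      ‖(⟨_, h⟩ : tandoriSpace X.kotheDual)‖ ≤ A * ‖f‖ := by
  obtain ⟨h, hn⟩ := hA.copsonAbs_mem f
  have hfin := hA.copsonLintegral_ne_top f
  obtain ⟨h1, h2⟩ := X.kotheDual.ideal ((majorantOp I).toLZero (copsonFun (f : LZero I))) ⟨_, h⟩ (by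
    filter_upwards [coeFn_copsonAbs (f : LZero I), hfin,
      (majorantOp I).coeFn_toLZero (copsonFun (f : LZero I))] with x h1 h2 h3
    rw [h1, h3, abs_of_nonneg ENNReal.toReal_nonneg, abs_of_nonneg ENNReal.toReal_nonneg]
    exact ENNReal.toReal_mono h2 (majorantOp_copsonFun_le _ _))
  exact ⟨⟨hfin.mono fun x hx => ne_top_of_le_ne_top hx (majorantOp_copsonFun_le _ _), h1⟩,
    h2.trans hn⟩

/-- The Copson operator as a bounded map from the Köthe dual to its Tandori space. -/
def CesaroEmbeds.copsonMap (hA : CesaroEmbeds X.toNormedIdealSpace A) :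
    X.kotheDual →L[ℝ] tandoriSpace X.kotheDual :=
  LinearMap.mkContinuous
    { toFun := fun f => ⟨_, (hA.copsonFun_mem f).1⟩
      map_add' := fun f g => Subtype.ext (AEEqFun.ext (by
        simp only [Submodule.coe_add]
        filter_upwards [coeFn_copsonFun (f : LZero I), coeFn_copsonFun (g : LZero I),
          coeFn_copsonFun ((f : LZero I) + (g : LZero I)), hA.copsonLintegral_ne_top f,
          hA.copsonLintegral_ne_top g,
          AEEqFun.coeFn_add (copsonFun (f : LZero I)) (copsonFun (g : LZero I))] with x h1 h2 h3 h4 h5 h6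
        rw [h6, Pi.add_apply, h1, h2, h3,
          ← integral_add (integrableOn_of_copsonLintegral_ne_top h4)
            (integrableOn_of_copsonLintegral_ne_top h5)]
        refine integral_congr_ae (ae_restrict_of_ae ?_)
        filter_upwards [AEEqFun.coeFn_add (f : LZero I) g] with t ht
        rw [ht, Pi.add_apply, add_div]))
      map_smul' := fun c f => Subtype.ext (AEEqFun.ext (by
        simp only [Submodule.coe_smul, RingHom.id_apply]
        filter_upwards [coeFn_copsonFun (f : LZero I), coeFn_copsonFun (c • (f : LZero I)),
          AEEqFun.coeFn_smul c (copsonFun (f : LZero I))] with x h1 h2 h3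
        rw [h3, Pi.smul_apply, h1, h2, smul_eq_mul, ← integral_const_mul]
        refine integral_congr_ae (ae_restrict_of_ae ?_)
        filter_upwards [AEEqFun.coeFn_smul c (f : LZero I)] with t ht
        rw [ht, Pi.smul_apply, smul_eq_mul, mul_div_assoc])) }
    A fun f => (hA.copsonFun_mem f).2

theorem CesaroEmbeds.coe_copsonMap (hA : CesaroEmbeds X.toNormedIdealSpace A)
    (f : X.kotheDual) : (hA.copsonMap f : LZero I) = copsonFun f := rfl

/-- `|f| ≤ f~` almost everywhere. -/
theorem enorm_le_majorantOp (f : LZero I) :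
    ∀ᵐ x ∂leb I, ‖f x‖ₑ ≤ (majorantOp I).toFun f x := by
  have hanti : Antitone ((majorantOp I).toFun f) := fun x y hxy =>
    essSup_mono_measure' (Measure.restrict_mono (Ici_subset_Ici.2 hxy) le_rfl)
  -- The essential supremum over `[x, ∞)` does not control the value at `x`. The bound by the
  -- majorant at rationals `q ≤ x` holds off one null set, and letting `q ↑ x` recovers the bound at
  -- `x` wherever the monotone majorant is continuous.
  have hcont : ∀ᵐ x ∂leb I, ContinuousAt ((majorantOp I).toFun f) x :=
    (ae_restrict_of_ae (hanti.countable_not_continuousAt.ae_notMem volume)).mono fun x hx => by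
      simpa using hx
  have hall : ∀ᵐ t ∂leb I, ∀ q : ℚ, (q : ℝ) ≤ t → ‖f t‖ₑ ≤ (majorantOp I).toFun f q := by
    rw [ae_all_iff]
    intro q
    exact (ae_restrict_iff' measurableSet_Ici).1
      (ENNReal.ae_le_essSup (μ := (leb I).restrict (Ici (q : ℝ))) fun t => ‖f t‖ₑ)
  filter_upwards [hcont, hall] with x h1 h2
  refine ge_of_tendsto (h1.mono_left nhdsWithin_le_nhds : Tendsto _ (𝓝[<] x) _) ?_
  filter_upwards [self_mem_nhdsWithin] with y hy
  obtain ⟨q, hq1, hq2⟩ := exists_rat_btwn (show y < x from hy)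
  exact (h2 q hq2.le).trans (hanti hq1.le)

theorem tandoriSpace_mem (X : NormedIdealSpace I) (f : tandoriSpace X) :
    ∃ h : (f : LZero I) ∈ X.toSubmodule, ‖(⟨_, h⟩ : X)‖ ≤ ‖f‖ := by
  refine X.ideal _ ⟨_, f.2.2⟩ ?_
  filter_upwards [enorm_le_majorantOp (f : LZero I), f.2.1,
    (majorantOp I).coeFn_toLZero (f : LZero I)] with x h1 h2 h3
  rw [h3, abs_of_nonneg ENNReal.toReal_nonneg, ← Real.norm_eq_abs, ← toReal_enorm]
  exact ENNReal.toReal_mono h2 h1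

/-- The inclusion of the Tandori space of `X` into `X`. -/
def tandoriInclusion (X : NormedIdealSpace I) : tandoriSpace X →L[ℝ] X :=
  LinearMap.mkContinuous
    { toFun := fun f => ⟨f, (tandoriSpace_mem X f).1⟩
      map_add' := fun _ _ => rfl
      map_smul' := fun _ _ => rfl } 1 fun f => by
        rw [one_mul]
        exact (tandoriSpace_mem X f).2

theorem coe_tandoriInclusion (X : NormedIdealSpace I) (f : tandoriSpace X) :
    (tandoriInclusion X f : LZero I) = f := rfl

end Maps

/-! ### Failure of the Dunford-Pettis property -/

section DunfordPettis

variable {I : Set ℝ} [hI : IsBaseInterval I] {X : BanachIdealSpace I} {A : ℝ}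

theorem mul_le_integral_of_le_on_Ioc {f : ℝ → ℝ} {c r s : ℝ} (hf : Integrable f (leb I))
    (h0 : ∀ᵐ x ∂leb I, 0 ≤ f x) (hr : 0 ≤ r) (hrs : r ≤ s) (hs : s ∈ I)
    (h : ∀ᵐ x ∂leb I, x ∈ Ioc r s → c ≤ f x) : c * (s - r) ≤ ∫ x, f x ∂leb I := by
  have h1 : ∫ _ in Ioc r s, c ∂leb I = c * (s - r) := by
    rw [setIntegral_const, measureReal_def, leb_Ioc hr hs,
      ENNReal.toReal_ofReal (sub_nonneg.2 hrs), smul_eq_mul, mul_comm]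
  rw [← h1]
  refine le_trans ?_ (setIntegral_le_integral (s := Ioc r s) hf h0)
  refine integral_mono_ae (integrableOn_const ?_) hf.integrableOn
    ((ae_restrict_iff' measurableSet_Ioc).2 h)
  rw [leb_Ioc hr hs]
  exact ENNReal.ofReal_ne_top

/-- On `(r, s]` the average of the indicator of `(a, r]` is `(r - a) / x`, at least `(r - a) / s`.
-/
theorem le_pairing_cesaroMap (hA : CesaroEmbeds X.toNormedIdealSpace A) {a r s : ℝ} (ha : 0 ≤ a)
    (har : a ≤ r) (hrs : r < s) (hs : s ∈ I) {w : X.kotheDual} {y : X.toNormedIdealSpace}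
    (hw : (w : LZero I) = chi I (Ioc r s) measurableSet_Ioc)
    (hy : (y : LZero I) = chi I (Ioc a r) measurableSet_Ioc) :
    (r - a) / s * (s - r) ≤ X.pairing w (cesaroMap X.toNormedIdealSpace (hA.embedding y)) := by
  have hr := ha.trans har
  have hspos : 0 < s := hr.trans_lt hrs
  have hc := coeFn_chi (I := I) (Ioc a r) measurableSet_Ioc
  have h0 : ∀ x, 0 ≤ ∫ t in Ioc 0 x, chi I (Ioc a r) measurableSet_Ioc t ∂leb I := fun x => by
    refine integral_nonneg_of_ae (ae_restrict_of_ae ?_)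
    filter_upwards [hc] with t ht
    rw [ht]
    exact indicator_nonneg (fun _ _ => zero_le_one) t
  have hval : ∀ x, r ≤ x →
      ∫ t in Ioc 0 x, chi I (Ioc a r) measurableSet_Ioc t ∂leb I = r - a := fun x hx => by
    rw [integral_congr_ae (ae_restrict_of_ae hc), integral_indicator measurableSet_Ioc,
      Measure.restrict_restrict measurableSet_Ioc,
      inter_eq_left.2 (Ioc_subset_Ioc ha hx), setIntegral_const, measureReal_def]
    rcases har.eq_or_lt with rfl | har
    · simp
    · rw [leb_Ioc ha (IsBaseInterval.Ioc_subset le_rfl hs ⟨ha.trans_lt har, hrs.le⟩),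
        ENNReal.toReal_ofReal (sub_nonneg.2 har.le), smul_eq_mul, mul_one]
  have hint := X.integrable_mul w (cesaroMap X.toNormedIdealSpace (hA.embedding y))
  rw [BanachIdealSpace.pairing_apply]
  simp only [coe_cesaroMap, hA.coe_embedding, hw, hy] at hint ⊢
  refine mul_le_integral_of_le_on_Ioc hint ?_ hr hrs.le hs ?_
  · filter_upwards [coeFn_chi (I := I) (Ioc r s) measurableSet_Ioc,
      coeFn_cesaroFun (chi I (Ioc a r) measurableSet_Ioc), ae_leb_pos (I := I)] with x h1 h2 h3
    rw [h1, h2]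
    exact mul_nonneg (indicator_nonneg (fun _ _ => zero_le_one) x)
      (mul_nonneg (inv_pos.2 h3).le (h0 x))
  · filter_upwards [coeFn_chi (I := I) (Ioc r s) measurableSet_Ioc,
      coeFn_cesaroFun (chi I (Ioc a r) measurableSet_Ioc), ae_leb_pos (I := I)] with x h1 h2 h3 hx
    rw [h1, h2, indicator_of_mem hx, one_mul, hval x hx.1.le, div_eq_inv_mul]
    exact mul_le_mul_of_nonneg_right (inv_anti₀ h3 hx.2) (sub_nonneg.2 har)

/-- For `x` in `(a, r]` the Copson integral of the indicator of `(r, s]` is `∫_r^s dt / t`, at least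
`(s - r) / s`. -/
theorem le_pairing_copsonMap (hA : CesaroEmbeds X.toNormedIdealSpace A) {a r s : ℝ} (ha : 0 ≤ a)
    (har : a < r) (hrs : r < s) (hs : s ∈ I) {w : X.kotheDual} {y : X.toNormedIdealSpace}
    (hw : (w : LZero I) = chi I (Ioc r s) measurableSet_Ioc)
    (hy : (y : LZero I) = chi I (Ioc a r) measurableSet_Ioc) :
    (s - r) / s * (r - a) ≤ X.pairing (tandoriInclusion X.kotheDual (hA.copsonMap w)) y := by
  have hr : 0 < r := ha.trans_lt har
  have hspos : 0 < s := hr.trans hrs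
  have hrI : r ∈ I := IsBaseInterval.Ioc_subset le_rfl hs ⟨hr, hrs.le⟩
  have hc := coeFn_chi (I := I) (Ioc r s) measurableSet_Ioc
  have hnn : ∀ᵐ t ∂leb I, 0 ≤ chi I (Ioc r s) measurableSet_Ioc t / t := by
    filter_upwards [hc, ae_leb_pos (I := I)] with t ht h0
    rw [ht]
    exact div_nonneg (indicator_nonneg (fun _ _ => zero_le_one) t) h0.le
  have hfin := hA.copsonLintegral_ne_top w
  have hint := X.integrable_mul (tandoriInclusion X.kotheDual (hA.copsonMap w)) y
  rw [BanachIdealSpace.pairing_apply]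
  simp only [coe_tandoriInclusion, hA.coe_copsonMap, hw, hy] at hint hfin ⊢
  refine mul_le_integral_of_le_on_Ioc hint ?_ ha har.le hrI ?_
  · filter_upwards [coeFn_chi (I := I) (Ioc a r) measurableSet_Ioc,
      coeFn_copsonFun (chi I (Ioc r s) measurableSet_Ioc)] with x h1 h2
    rw [h1, h2]
    exact mul_nonneg (integral_nonneg_of_ae (ae_restrict_of_ae hnn))
      (indicator_nonneg (fun _ _ => zero_le_one) x)
  · filter_upwards [coeFn_chi (I := I) (Ioc a r) measurableSet_Ioc,
      coeFn_copsonFun (chi I (Ioc r s) measurableSet_Ioc), hfin] with x h1 h2 h3 hx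
    rw [h1, h2, indicator_of_mem hx, mul_one, ← integral_indicator measurableSet_Ici,
      div_eq_inv_mul]
    refine mul_le_integral_of_le_on_Ioc ((integrable_indicator_iff measurableSet_Ici).2
      (integrableOn_of_copsonLintegral_ne_top h3)) ?_ hr.le hrs.le hs ?_
    · filter_upwards [hnn] with t ht
      exact indicator_apply_nonneg fun _ => ht
    · filter_upwards [hc] with t ht htm
      rw [indicator_of_mem (show t ∈ Ici x from hx.2.trans htm.1.le), ht, indicator_of_mem htm,
        one_div]
      exact inv_anti₀ (hr.trans htm.1) htm.2

/-- In a symmetric space, the norm of the indicator function of an interval increases with its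
length. -/
theorem NormedIdealSpace.IsSymmetric.norm_chi_le {X : NormedIdealSpace I} (hX : X.IsSymmetric)
    {a r b s : ℝ} (ha : 0 ≤ a) (hb : 0 ≤ b) (hr : r ∈ I) (hs : s ∈ I)
    (har : a < r) (hle : r - a ≤ s - b)
    (h₁ : chi I (Ioc a r) measurableSet_Ioc ∈ X.toSubmodule)
    (h₂ : chi I (Ioc b s) measurableSet_Ioc ∈ X.toSubmodule) :
    ‖(⟨_, h₁⟩ : X)‖ ≤ ‖(⟨_, h₂⟩ : X)‖ := by
  -- The distribution function of an interval's indicator depends only on the length, so `(a, r]`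
  -- can be moved to the left end of `(b, s]`.
  have hdist : ∀ (p q : ℝ), 0 ≤ p → p ≤ q → q ∈ I → ∀ t : ℝ, 0 < t →
      distrib (chi I (Ioc p q) measurableSet_Ioc) t =
        if t < 1 then ENNReal.ofReal (q - p) else 0 := by
    intro p q hp hpq hq t ht
    have : distrib (chi I (Ioc p q) measurableSet_Ioc) t =
        leb I (if t < 1 then Ioc p q else ∅) := by
      refine measure_congr ?_
      filter_upwards [coeFn_chi (I := I) (Ioc p q) measurableSet_Ioc] with x hx
      refine propext ?_
      change t < |chi I (Ioc p q) measurableSet_Ioc x| ↔ x ∈ (if t < 1 then Ioc p q else ∅)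
      rw [hx]
      by_cases hxm : x ∈ Ioc p q
      · rw [indicator_of_mem hxm, abs_one]
        split_ifs with h <;> simp_all
      · rw [indicator_of_notMem hxm, abs_zero]
        split_ifs with h <;> simp only [hxm, mem_empty_iff_false, iff_false, not_lt, ht.le]
    rw [this]
    split_ifs
    · exact leb_Ioc hp hq
    · exact measure_empty
  have hbI : b + (r - a) ∈ I :=
    IsBaseInterval.Ioc_subset le_rfl hs ⟨by linarith, by linarith⟩
  have hq : ∀ t : ℝ, 0 < t → distrib (chi I (Ioc a r) measurableSet_Ioc) t =
      distrib (chi I (Ioc b (b + (r - a))) measurableSet_Ioc) t := by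
    intro t ht
    rw [hdist a r ha har.le hr t ht, hdist b _ hb (by linarith) hbI t ht, add_sub_cancel_left]
  obtain ⟨h₃, h₄⟩ := hX ⟨_, h₁⟩ _ hq
  rw [← h₄]
  refine X.norm_le_of_abs_le ?_
  filter_upwards [coeFn_chi (I := I) (Ioc b s) measurableSet_Ioc,
    coeFn_chi (I := I) (Ioc b (b + (r - a))) measurableSet_Ioc] with x h5 h6
  rw [h5, h6]
  by_cases hx : x ∈ Ioc b (b + (r - a))
  · rw [indicator_of_mem hx, indicator_of_mem (show x ∈ Ioc b s from ⟨hx.1, by linarith [hx.2]⟩)]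
  · simp [indicator_of_notMem hx]

theorem half_pow_mem (n : ℕ) : (1 / 2 : ℝ) ^ n ∈ I := by
  have h0 : (0 : ℝ) ≤ (1 / 2) ^ n := by positivity
  rcases hI.eq_or_eq with rfl | rfl
  · exact ⟨h0, pow_le_one₀ (by norm_num) (by norm_num)⟩
  · exact h0

theorem eventually_half_pow_lt (k : ℕ) {a : ℝ} (ha : 0 < a) :
    ∀ᶠ n : ℕ in atTop, (1 / 2 : ℝ) ^ (n + k) < a :=
  ((tendsto_pow_atTop_nhds_zero_of_lt_one (by norm_num) (by norm_num)).comp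
    (tendsto_add_atTop_nat k)).eventually_lt_const ha

/-- Normalized indicator functions of dyadic intervals in `X` and in `X'`: both sequences are
weakly null, but they are not asymptotically orthogonal through the Cesàro and
Copson operators. -/
theorem CesaroEmbeds.exists_sequences (hA : CesaroEmbeds X.toNormedIdealSpace A)
    (hS : X.IsSymmetric) (hX : IsReflexiveSpace X.toNormedIdealSpace) :
    ∃ (u : ℕ → X.toNormedIdealSpace) (v : ℕ → X.kotheDual),
      (∀ ψ : StrongDual ℝ X.toNormedIdealSpace, Tendsto (fun n => ψ (u n)) atTop (𝓝 0)) ∧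
      (∀ f, Tendsto (fun n => X.pairing (v n) f) atTop (𝓝 0)) ∧
      ∀ n, 1 / 16 ≤ X.pairing (v n) (cesaroMap X.toNormedIdealSpace (hA.embedding (u n))) ∧
        1 / 16 ≤ X.pairing (tandoriInclusion X.kotheDual (hA.copsonMap (v n))) (u n) := by
  have hpos : ∀ n : ℕ, (0 : ℝ) < (1 / 2) ^ n := fun n => by positivity
  have hlt : ∀ n : ℕ, (1 / 2 : ℝ) ^ (n + 1) < (1 / 2) ^ n := fun n => by
    have := hpos n
    rw [pow_succ]
    linarith
  have hmem := fun n : ℕ => hA.chi_mem (hpos (n + 1)) (hlt n) (half_pow_mem n)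
  set e : ℕ → X.toNormedIdealSpace := fun n => ⟨_, hmem n⟩ with he
  have hepos : ∀ n, 0 < ‖e n‖ := fun n =>
    hA.norm_chi_pos (hpos (n + 1)) (hlt n) (half_pow_mem n)
  -- Symmetry enters here: the normalization of `v n` uses `‖e n‖`, that of `u n` uses `‖e (n +
  -- 2)‖`.
  have hanti : ∀ n, ‖e (n + 2)‖ ≤ ‖e n‖ := fun n => by
    refine hS.norm_chi_le (hpos _).le (hpos _).le (half_pow_mem _) (half_pow_mem _) (hlt _) ?_ _ _
    have := hpos n
    simp only [pow_succ]
    linarith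
  have hdual : ∀ n : ℕ, ∃ h : chi I (Ioc ((1 / 2 : ℝ) ^ (n + 2)) ((1 / 2) ^ (n + 1)))
      measurableSet_Ioc ∈ X.kotheDual.toSubmodule,
      ‖(⟨_, h⟩ : X.kotheDual)‖ ≤ (1 / 2) ^ n * A / ‖e n‖ := fun n => by
    obtain ⟨h1, h2⟩ := hA.chi_mem_kotheDual (hpos (n + 1)) (hlt n) (half_pow_mem n)
    obtain ⟨h3, h4⟩ := X.kotheDual.ideal
      (chi I (Ioc ((1 / 2 : ℝ) ^ (n + 2)) ((1 / 2) ^ (n + 1))) measurableSet_Ioc) ⟨_, h1⟩ (by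
      filter_upwards [coeFn_chi (I := I) (Ioc ((1 / 2 : ℝ) ^ (n + 2)) ((1 / 2) ^ (n + 1)))
        measurableSet_Ioc, coeFn_chi (I := I) (Ioc 0 ((1 / 2 : ℝ) ^ (n + 1))) measurableSet_Ioc]
        with x h5 h6
      rw [h5, h6, abs_of_nonneg (indicator_nonneg (fun _ _ => zero_le_one) x),
        abs_of_nonneg (indicator_nonneg (fun _ _ => zero_le_one) x)]
      exact indicator_le_indicator_of_subset (Ioc_subset_Ioc_left (hpos _).le)
        (fun _ => zero_le_one) x)
    exact ⟨h3, h4.trans h2⟩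
  choose hmem' hle using hdual
  set d : ℕ → X.kotheDual := fun n => ⟨_, hmem' n⟩ with hd
  -- Here `t` stands for the pairing before normalization; the factor `2 ^ n` cancels its decay and
  -- the ratio of norms is at least `1`.
  have hlower : ∀ (n : ℕ) (t : ℝ), (1 / 2) ^ n * (1 / 16) ≤ t →
      1 / 16 ≤ ‖e (n + 2)‖⁻¹ * (2 ^ n * ‖e n‖ * t) := fun n t ht => by
    have h1 : 1 ≤ ‖e n‖ * ‖e (n + 2)‖⁻¹ := by
      rw [← div_eq_mul_inv, one_le_div (hepos _)]
      exact hanti n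
    have h2 : (1 : ℝ) / 16 ≤ 2 ^ n * t := by
      calc (1 : ℝ) / 16 = 2 ^ n * ((1 / 2) ^ n * (1 / 16)) := by
            rw [← mul_assoc, ← mul_pow]
            norm_num
        _ ≤ 2 ^ n * t := by gcongr
    calc (1 : ℝ) / 16 ≤ 1 * (2 ^ n * t) := by rwa [one_mul]
      _ ≤ (‖e n‖ * ‖e (n + 2)‖⁻¹) * (2 ^ n * t) :=
        mul_le_mul_of_nonneg_right h1 (le_trans (by norm_num) h2)
      _ = ‖e (n + 2)‖⁻¹ * (2 ^ n * ‖e n‖ * t) := by ring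
  -- The shift by `2` makes the support of `e (n + 2)` end where that of `d n` begins; `2 ^ n * ‖e
  -- n‖` compensates the bound on `d n`, leaving norm at most `A`.
  refine ⟨fun n => ‖e (n + 2)‖⁻¹ • e (n + 2), fun n => (2 ^ n * ‖e n‖) • d n, fun ψ => ?_, ?_,
    fun n => ⟨?_, ?_⟩⟩
  · rw [← map_zero ψ]
    refine hA.tendsto_weakly hX (M := 1) (fun n => ?_) (fun a ha => ?_) ψ
    · rw [norm_smul, norm_inv, norm_norm, inv_mul_cancel₀ (hepos _).ne']
    · filter_upwards [eventually_half_pow_lt 2 ha] with n hn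
      filter_upwards [AEEqFun.coeFn_smul ‖e (n + 2)‖⁻¹ (e (n + 2) : LZero I),
        coeFn_chi (I := I) (Ioc ((1 / 2 : ℝ) ^ (n + 2 + 1)) ((1 / 2) ^ (n + 2))) measurableSet_Ioc,
        AEEqFun.coeFn_zero (α := ℝ) (μ := leb I) (β := ℝ)] with x h1 h2 h3 hx
      rw [Submodule.coe_smul, Submodule.coe_zero, h1, h3, Pi.smul_apply, h2,
        indicator_of_notMem fun h => absurd h.2 (not_le.2 (hn.trans hx)), smul_zero]
      rfl
  · refine hA.tendsto_pairing_zero hX (M := A) (fun n => ?_) (fun a ha => ?_)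
    · rw [norm_smul, Real.norm_of_nonneg (by positivity)]
      refine (mul_le_mul_of_nonneg_left (hle n) (by positivity)).trans_eq ?_
      have h1 : (2 : ℝ) ^ n * (1 / 2) ^ n = 1 := by
        rw [← mul_pow]
        norm_num
      have h2 := (hepos n).ne'
      field_simp
      linear_combination A * h1
    · filter_upwards [eventually_half_pow_lt 1 ha] with n hn
      filter_upwards [AEEqFun.coeFn_smul (2 ^ n * ‖e n‖) (d n : LZero I),
        coeFn_chi (I := I) (Ioc ((1 / 2 : ℝ) ^ (n + 2)) ((1 / 2) ^ (n + 1))) measurableSet_Ioc]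
        with x h1 h2 hx
      rw [Submodule.coe_smul, h1, Pi.smul_apply, h2,
        indicator_of_notMem fun h => absurd h.2 (not_le.2 (hn.trans hx)), smul_zero]
  · simp only [map_smul, smul_apply, smul_eq_mul]
    refine hlower n _ ?_
    -- With `a, r, s = 2^(-n-3), 2^(-n-2), 2^(-n-1)` the bound is `(1/4) · 2^(-n-2)`.
    refine le_trans (le_of_eq ?_) (le_pairing_cesaroMap hA (hpos (n + 3)).le (hlt (n + 2)).le
      (hlt (n + 1)) (half_pow_mem (n + 1)) (w := d n) (y := e (n + 2)) rfl rfl)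
    have := (hpos n).ne'
    simp only [pow_succ]
    field_simp
    norm_num
  · simp only [map_smul, smul_apply, smul_eq_mul]
    refine hlower n _ ?_
    -- The same three points give `(1/2) · 2^(-n-3)`, again `2^(-n) / 16`.
    refine le_trans (le_of_eq ?_) (le_pairing_copsonMap hA (hpos (n + 3)).le (hlt (n + 2))
      (hlt (n + 1)) (half_pow_mem (n + 1)) (w := d n) (y := e (n + 2)) rfl rfl)
    have := (hpos n).ne'
    simp only [pow_succ]
    field_simp
    norm_num

theorem not_tendsto_zero_of_le {f : ℕ → ℝ} {c : ℝ} (hc : 0 < c) (h : ∀ n, c ≤ f n) :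
    ¬ Tendsto f atTop (𝓝 0) := fun ht =>
  (ge_of_tendsto' ht h).not_gt hc

/-- The Cesàro space and the Tandori space of the Köthe dual fail the Dunford-Pettis property
whenever `X` is reflexive and symmetric and the Cesàro operator is bounded on `X`. -/
theorem not_hasDunfordPettis (hC : X.CesaroBounded) (hS : X.IsSymmetric)
    (hX : IsReflexiveSpace X.toNormedIdealSpace) :
    ¬ HasDunfordPettis (cesaroSpace X.toNormedIdealSpace) ∧
      ¬ HasDunfordPettis (tandoriSpace X.kotheDual) := by
  obtain ⟨A, hA⟩ := hC.exists_embeds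
  obtain ⟨u, v, hu, hv, huv⟩ := hA.exists_sequences hS hX
  refine ⟨fun h => ?_, fun h => ?_⟩
  · refine not_tendsto_zero_of_le (by norm_num) (fun n => (huv n).1)
      (h (fun n => hA.embedding (u n))
        (fun n => (X.pairing (v n)).comp (cesaroMap X.toNormedIdealSpace))
        (fun ψ => hu (ψ.comp hA.embedding)) fun Ψ => ?_)
    -- Composed with the adjoint of `CX → X`, the functional `Ψ` becomes an element of `X**`, hence
    -- evaluation at some `y` in `X`.
    obtain ⟨y, hy⟩ := hX (Ψ.comp
      ((ContinuousLinearMap.compL ℝ _ _ ℝ).flip (cesaroMap X.toNormedIdealSpace)))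
    refine (hv y).congr fun n => ?_
    exact DFunLike.congr_fun hy (X.pairing (v n))
  · refine not_tendsto_zero_of_le (by norm_num) (fun n => (huv n).2)
      (h (fun n => hA.copsonMap (v n))
        (fun n => (X.pairing.flip (u n)).comp (tandoriInclusion X.kotheDual))
        (fun ψ => hX.weakly_null_of_embedding X.pairingIsometry hv (ψ.comp hA.copsonMap))
        fun Ψ => ?_)
    -- The functionals are images of `u n` under a bounded map from `X` to the dual of the Tandori
    -- space, so `Ψ` pulls back to an element of `X*`.
    exact hu (Ψ.comp (((ContinuousLinearMap.compL ℝ _ _ ℝ).flip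
      (tandoriInclusion X.kotheDual)).comp X.pairing.flip))

end DunfordPettis

end

theorem theorem4p9 :
    (∀ X : BanachIdealSpace (Set.Ici (0 : ℝ)),
      X.IsSymmetric → IsReflexiveSpace X.toNormedIdealSpace → X.CesaroBounded →
        ¬ HasDunfordPettis (cesaroSpace X.toNormedIdealSpace) ∧
        ¬ HasDunfordPettis (tandoriSpace X.kotheDual)) ∧
    (∀ X : BanachIdealSpace (Set.Icc (0 : ℝ) 1),
      X.IsSymmetric → IsReflexiveSpace X.toNormedIdealSpace → X.CesaroBounded →
      X.HasFatou → X.CopsonBounded →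
        ¬ HasDunfordPettis (cesaroSpace X.toNormedIdealSpace) ∧
        ¬ HasDunfordPettis (tandoriSpace X.kotheDual)) :=
  ⟨fun _ hS hX hC => not_hasDunfordPettis hC hS hX,
    fun _ hS hX hC _ _ => not_hasDunfordPettis hC hS hX⟩
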